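/- Let $\Omega\subset\mathbb R^3$ be a polyhedral domain, that is, a bounded, connected, non-empty open set with $\operatorname{int}\overline\Omega=\Omega$ whose closure is a finite union of tetrahedra, and let $\mathcal T_h=\{T_1,\dots,T_{n_t}\}$ be a conforming tetrahedral grid on $\Omega$: the $T_k$ are non-degenerate closed tetrahedra with pairwise different vertex sets, $\bigcup_k T_k=\overline\Omega$, and any two different ones meet exactly in the convex hull of their common vertices. Let the four vertices of each $T\in\mathcal T_h$ be numbered, in an arbitrary way, $a_0,a_1,a_2,a_3$. Let $\hat{\mathbf b}=(\hat b_1,\hat b_2,\hat b_3)$ be the polynomial vector field of degree $4$ on the reference tetrahedron with vertices $0,e_1,e_2,e_3$ given by $$\begin{aligned}\hat b_1={}&\tfrac{263}{12}x^4+38x^3y+\tfrac{265}{3}x^3z+29x^2y^2+96x^2yz+\tfrac{209}{2}x^2z^2-16xy^3+42xy^2z+42xyz^2+\tfrac{103}{3}xz^3+\tfrac76y^4-y^2z^2-\tfrac{335}{12}z^4-\tfrac{253}{6}x^3\\&-\tfrac{87}{2}x^2y-119x^2z+\tfrac{21}{2}xy^2-56xyz-65xz^2+\tfrac{112}{3}z^3+\tfrac{703}{28}x^2+\tfrac72xy+\tfrac{251}{7}xz-\tfrac{41}{28}y^2+\tfrac27yz-\tfrac{169}{14}z^2-\tfrac{181}{42}x+\tfrac{13}{21}y+\tfrac{73}{840},\\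 \hat b_2={}&-\tfrac{233}{3}x^3y+\tfrac{67}{9}x^3z-\tfrac{233}{2}x^2y^2-235x^2yz+\tfrac{163}{6}x^2z^2-\tfrac{203}{3}xy^3-225xy^2z-209xyz^2+\tfrac{301}{9}xz^3-\tfrac{64}{3}y^3z-21y^2z^2-\tfrac{16}{3}yz^3\\&+\tfrac{113}{18}x^3+\tfrac{1105}{8}x^2y+\tfrac{155}{24}x^2z+\tfrac{1025}{8}xy^2+\tfrac{1077}{4}xyz-\tfrac{469}{24}xz^2+\tfrac{79}{8}y^3+\tfrac{417}{8}y^2z+\tfrac{289}{8}yz^2-\tfrac{199}{72}z^3-\tfrac{625}{56}x^2-\tfrac{505}{7}xy\\&-\tfrac{94}{7}xz-\tfrac{447}{28}y^2-\tfrac{251}{7}yz+\tfrac{317}{56}x+\tfrac{625}{84}y+\tfrac{101}{42}z-\tfrac{383}{630},\\ \hat b_3={}&-10x^3y-10x^3z+x^2y^2+119x^2yz-15x^2z^2+16xy^3+145xy^2z+129xyz^2+16y^3z+11y^2z^2-\tfrac{29}{4}z^4-\tfrac{93}{8}x^2y\\&-\tfrac{61}{8}x^2z-\tfrac{301}{8}xy^2-\tfrac{693}{4}xyz-\tfrac{141}{8}xz^2-\tfrac{13}{4}y^3-\tfrac{321}{8}y^2z-\tfrac{193}{8}yz^2+\tfrac{77}{8}z^3+\tfrac{181}{56}x^2+\tfrac{363}{14}xy+\tfrac{307}{14}xz+\tfrac{389}{56}y^2\\&+\tfrac{199}{7}yz-\tfrac{563}{168}x-\tfrac{33}{8}y-\tfrac{263}{84}z+\tfrac{103}{210}.\end{aligned}$$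 For $T\in\mathcal T_h$ and $i=1,\dots,9$ let $F_{T,i}$ be the affine map that sends $0,e_1,e_2,e_3$ to $a_{\sigma_i(0)},a_{\sigma_i(1)},a_{\sigma_i(2)},a_{\sigma_i(3)}$, where $\sigma_1,\dots,\sigma_9$ are the permutations $0123,\,0231,\,0312,\,1203,\,1032,\,1320,\,2013,\,2301,\,3021$ (listed by their values), let $J_{T,i}$ be its Jacobi matrix, and let $\mathbf b_{T,i}(\mathbf x)=J_{T,i}\,\hat{\mathbf b}(F_{T,i}^{-1}(\mathbf x))$ on (the interior of) $T$, extended by zero elsewhere. Put $$\mathbf V_h=\Big\{\mathbf v_c+\sum_{T\in\mathcal T_h}\sum_{i=1}^9 d_{T,i}\,\mathbf b_{T,i}\ :\ \mathbf v_c\in C(\overline\Omega)^3,\ \mathbf v_c|_T\in P_3(T)^3\ \ \forall T\in\mathcal T_h,\ \mathbf v_c|_{\partial\Omega}=\mathbf 0,\ d_{T,i}\in\mathbb R\Big\},$$ $$P_h=\Big\{p_h\in L^2(\Omega)\ :\ \int_\Omega p_h=0,\ \ p_h|_T\in P_2(T)\ \ \forall T\in\mathcal T_h\Big\},$$ where $P_k(T)$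 denotes the polynomials of total degree at most $k$ on $T$. Write $(\cdot,\cdot)$ for the $L^2(\Omega)$ inner product, with the gradient and the divergence of functions in $\mathbf V_h$ taken tetrahedron by tetrahedron. Then for every $\mathbf f\in L^2(\Omega)^3$ there is exactly one pair $(\mathbf u_h,p_h)\in\mathbf V_h\times P_h$ such that $$(\nabla\mathbf u_h,\nabla\mathbf v_h)-(\operatorname{div}\mathbf v_h,p_h)=(\mathbf f,\mathbf v_h)\quad\forall\,\mathbf v_h\in\mathbf V_h,\qquad(\operatorname{div}\mathbf u_h,q_h)=0\quad\forall\,q_h\in P_h.$$ -/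

import Mathlib

open MeasureTheory

noncomputable section

/-- Euclidean three-space. -/
abbrev E3 : Type := EuclideanSpace ℝ (Fin 3)

/-- A (conforming) tetrahedral grid `T_1, …, T_{n_t}` on the domain `Ω`. Every tetrahedron carries
a numbering of its four vertices; the grid is an arbitrary one, with arbitrary numberings. Two
different tetrahedra have different vertex sets, and they meet exactly in the (possibly empty)
common face spanned by their common vertices. -/
structure TetMesh (Ω : Set E3) where
  /-- the number of tetrahedra -/
  nt : ℕ
  /-- the numbered vertices of the tetrahedra -/
  vertex : Fin nt → Fin 4 → E3
  affineIndependent : ∀ T, AffineIndependent ℝ (vertex T)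
  range_ne : ∀ T T', T ≠ T' → Set.range (vertex T) ≠ Set.range (vertex T')
  inter_eq : ∀ T T', T ≠ T' →
    convexHull ℝ (Set.range (vertex T)) ∩ convexHull ℝ (Set.range (vertex T')) =
      convexHull ℝ (Set.range (vertex T) ∩ Set.range (vertex T'))
  cover : (⋃ T, convexHull ℝ (Set.range (vertex T))) = closure Ω

/-- First component of the reference bubble, in the coordinates of the reference tetrahedron. -/
def refBubble1 (x y z : ℝ) : ℝ :=
  263 / 12 * x ^ 4 + 38 * x ^ 3 * y + 265 / 3 * x ^ 3 * z
    + 29 * x ^ 2 * y ^ 2 + 96 * x ^ 2 * y * z + 209 / 2 * x ^ 2 * z ^ 2 - 16 * x * y ^ 3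
    + 42 * x * y ^ 2 * z + 42 * x * y * z ^ 2 + 103 / 3 * x * z ^ 3
    + 7 / 6 * y ^ 4 - y ^ 2 * z ^ 2 - 335 / 12 * z ^ 4 - 253 / 6 * x ^ 3
    - 87 / 2 * x ^ 2 * y - 119 * x ^ 2 * z + 21 / 2 * x * y ^ 2 - 56 * x * y * z
    - 65 * x * z ^ 2 + 112 / 3 * z ^ 3 + 703 / 28 * x ^ 2
    + 7 / 2 * x * y + 251 / 7 * x * z - 41 / 28 * y ^ 2
    + 2 / 7 * y * z - 169 / 14 * z ^ 2
    - 181 / 42 * x + 13 / 21 * y + 73 / 840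

/-- Second component of the reference bubble. -/
def refBubble2 (x y z : ℝ) : ℝ :=
  -(233 / 3) * x ^ 3 * y + 67 / 9 * x ^ 3 * z - 233 / 2 * x ^ 2 * y ^ 2
    - 235 * x ^ 2 * y * z + 163 / 6 * x ^ 2 * z ^ 2 - 203 / 3 * x * y ^ 3
    - 225 * x * y ^ 2 * z - 209 * x * y * z ^ 2 + 301 / 9 * x * z ^ 3
    - 64 / 3 * y ^ 3 * z - 21 * y ^ 2 * z ^ 2 - 16 / 3 * y * z ^ 3
    + 113 / 18 * x ^ 3 + 1105 / 8 * x ^ 2 * y + 155 / 24 * x ^ 2 * z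
    + 1025 / 8 * x * y ^ 2 + 1077 / 4 * x * y * z - 469 / 24 * x * z ^ 2
    + 79 / 8 * y ^ 3 + 417 / 8 * y ^ 2 * z + 289 / 8 * y * z ^ 2
    - 199 / 72 * z ^ 3 - 625 / 56 * x ^ 2 - 505 / 7 * x * y
    - 94 / 7 * x * z - 447 / 28 * y ^ 2
    - 251 / 7 * y * z + 317 / 56 * x + 625 / 84 * y + 101 / 42 * z - 383 / 630

/-- Third component of the reference bubble. -/
def refBubble3 (x y z : ℝ) : ℝ :=
  -10 * x ^ 3 * y - 10 * x ^ 3 * z + x ^ 2 * y ^ 2 + 119 * x ^ 2 * y * z - 15 * x ^ 2 * z ^ 2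
    + 16 * x * y ^ 3
    + 145 * x * y ^ 2 * z + 129 * x * y * z ^ 2 + 16 * y ^ 3 * z + 11 * y ^ 2 * z ^ 2
    - 29 / 4 * z ^ 4 - 93 / 8 * x ^ 2 * y
    - 61 / 8 * x ^ 2 * z - 301 / 8 * x * y ^ 2 - 693 / 4 * x * y * z
    - 141 / 8 * x * z ^ 2 - 13 / 4 * y ^ 3 - 321 / 8 * y ^ 2 * z
    - 193 / 8 * y * z ^ 2 + 77 / 8 * z ^ 3 + 181 / 56 * x ^ 2
    + 363 / 14 * x * y + 307 / 14 * x * z + 389 / 56 * y ^ 2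
    + 199 / 7 * y * z - 563 / 168 * x - 33 / 8 * y - 263 / 84 * z
    + 103 / 210

/-- The `P₄` bubble on the reference tetrahedron with vertices `0, e₁, e₂, e₃`. -/
def refBubble (s : Fin 3 → ℝ) : Fin 3 → ℝ :=
  ![refBubble1 (s 0) (s 1) (s 2), refBubble2 (s 0) (s 1) (s 2), refBubble3 (s 0) (s 1) (s 2)]

/-- The nine renumberings of the vertices of a tetrahedron. In terms of vertices named
`1, 6, 7, 2` (in this order) they are
`1672, 1726, 1267, 6712, 6127, 6271, 7162, 7216, 2176`. -/
def renumbering : Fin 9 → Fin 4 → Fin 4 :=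
  ![![0, 1, 2, 3], ![0, 2, 3, 1], ![0, 3, 1, 2],
    ![1, 2, 0, 3], ![1, 0, 3, 2], ![1, 3, 2, 0],
    ![2, 0, 1, 3], ![2, 3, 0, 1], ![3, 0, 2, 1]]

/-- The Jacobi matrix of the affine map that sends `0, e₁, e₂, e₃` to `a 0, a 1, a 2, a 3`. -/
def jacobiMatrix (a : Fin 4 → E3) : Matrix (Fin 3) (Fin 3) ℝ :=
  Matrix.of fun m k => a k.succ m - a 0 m

/-- The mapped bubble `x ↦ J b̂(F⁻¹ x)`, where `F s = a 0 + J s` is the affine map that sends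
`0, e₁, e₂, e₃` to `a 0, a 1, a 2, a 3`. -/
def mappedBubble (a : Fin 4 → E3) (x : E3) : E3 :=
  WithLp.toLp 2 (Matrix.mulVec (jacobiMatrix a)
    (refBubble (Matrix.mulVec (jacobiMatrix a)⁻¹ (WithLp.ofLp (x - a 0)))))

/-- The classical divergence of a vector field at a point. -/
def divAt (v : E3 → E3) (x : E3) : ℝ :=
  ∑ j : Fin 3, (fderiv ℝ v x (EuclideanSpace.single j 1)) j

/-- The Frobenius product `∇u : ∇v` at a point. -/
def gradInnerAt (u v : E3 → E3) (x : E3) : ℝ :=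
  ∑ i : Fin 3, ∑ j : Fin 3,
    (fderiv ℝ u x (EuclideanSpace.single j 1)) i * (fderiv ℝ v x (EuclideanSpace.single j 1)) i

namespace TetMesh

variable {Ω : Set E3} (M : TetMesh Ω)

/-- The closed tetrahedron number `T`. -/
def tet (T : Fin M.nt) : Set E3 := convexHull ℝ (Set.range (M.vertex T))

/-- The bubble `b_i` of the tetrahedron `T`, extended by zero outside `T`. (On the faces of the
grid, a null set, the value zero is a convention.) -/
def bubble (T : Fin M.nt) (i : Fin 9) : E3 → E3 :=
  (interior (M.tet T)).indicator (mappedBubble fun k => M.vertex T (renumbering i k))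

/-- The conforming vector `P₃` functions on the grid, i.e. the continuous functions on `closure Ω`
that are componentwise polynomials of degree at most `3` on every tetrahedron, with zero boundary
values. They are extended by zero outside `Ω`. -/
def conformingP3 : Submodule ℝ (E3 → E3) where
  carrier := {v | ContinuousOn v (closure Ω) ∧ (∀ x, x ∉ Ω → v x = 0) ∧
    ∀ T, ∀ m : Fin 3, ∃ q ∈ MvPolynomial.restrictTotalDegree (Fin 3) ℝ 3,
      ∀ x ∈ M.tet T, v x m = MvPolynomial.eval (fun k => x k) q}
  zero_mem' := ⟨continuousOn_const, fun _ _ => rfl, fun _ _ => ⟨0, Submodule.zero_mem _, by simp⟩⟩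
  add_mem' := by
    rintro u v ⟨hu, hu0, hup⟩ ⟨hv, hv0, hvp⟩
    refine ⟨hu.add hv, fun x hx => by simp [hu0 x hx, hv0 x hx], fun T m => ?_⟩
    obtain ⟨p, hp, hpe⟩ := hup T m
    obtain ⟨q, hq, hqe⟩ := hvp T m
    exact ⟨p + q, Submodule.add_mem _ hp hq, fun x hx => by simp [hpe x hx, hqe x hx]⟩
  smul_mem' := by
    rintro c v ⟨hv, hv0, hvp⟩
    refine ⟨hv.const_smul c, fun x hx => by simp [hv0 x hx], fun T m => ?_⟩
    obtain ⟨q, hq, hqe⟩ := hvp T m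
    exact ⟨c • q, Submodule.smul_mem _ c hq, fun x hx => by simp [hqe x hx]⟩

/-- The velocity space `V_h`: the sums `v_c + v_b` of a conforming `P₃` function `v_c` with zero
boundary values and a linear combination `v_b` of the nine bubbles of all tetrahedra. -/
def velocitySpace : Submodule ℝ (E3 → E3) :=
  M.conformingP3 ⊔
    Submodule.span ℝ (Set.range fun Ti : Fin M.nt × Fin 9 => M.bubble Ti.1 Ti.2)

/-- The pressure space `P_h`: the functions in `L²(Ω)` of mean value zero that are polynomials of
degree at most `2` on every tetrahedron. -/
def pressureSpace : Submodule ℝ (Lp ℝ 2 (volume.restrict Ω)) where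
  carrier := {p | (Integrable p (volume.restrict Ω) ∧ ∫ x in Ω, p x = 0) ∧
    ∀ T, ∃ q ∈ MvPolynomial.restrictTotalDegree (Fin 3) ℝ 2,
      ∀ᵐ x ∂(volume.restrict Ω), x ∈ M.tet T → p x = MvPolynomial.eval (fun k => x k) q}
  zero_mem' := by
    have h := Lp.coeFn_zero ℝ 2 (volume.restrict Ω)
    refine ⟨⟨(integrable_zero _ _ _).congr h.symm, ?_⟩, fun T => ⟨0, Submodule.zero_mem _, ?_⟩⟩
    · rw [integral_congr_ae h]; simp
    · filter_upwards [h] with x hx _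
      rw [hx]; simp
  add_mem' := by
    rintro p p' ⟨⟨hi, h0⟩, hp⟩ ⟨⟨hi', h0'⟩, hp'⟩
    have h := Lp.coeFn_add p p'
    refine ⟨⟨(hi.add hi').congr h.symm, ?_⟩, fun T => ?_⟩
    · rw [integral_congr_ae h]
      simp only [Pi.add_apply]
      rw [integral_add hi hi', h0, h0', add_zero]
    · obtain ⟨q, hq, hqe⟩ := hp T
      obtain ⟨q', hq', hqe'⟩ := hp' T
      refine ⟨q + q', Submodule.add_mem _ hq hq', ?_⟩
      filter_upwards [h, hqe, hqe'] with x hx hx1 hx2 hxT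
      rw [hx]; simp [hx1 hxT, hx2 hxT]
  smul_mem' := by
    rintro c p ⟨⟨hi, h0⟩, hp⟩
    have h := Lp.coeFn_smul c p
    refine ⟨⟨(hi.smul c).congr h.symm, ?_⟩, fun T => ?_⟩
    · rw [integral_congr_ae h]
      simp only [Pi.smul_apply]
      rw [integral_smul, h0, smul_zero]
    · obtain ⟨q, hq, hqe⟩ := hp T
      refine ⟨c • q, Submodule.smul_mem _ c hq, ?_⟩
      filter_upwards [h, hqe] with x hx hx1 hxT
      rw [hx]; simp [hx1 hxT]

/-- The broken form `(∇u, ∇v)`, computed tetrahedron by tetrahedron. -/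
def gradForm (u v : E3 → E3) : ℝ :=
  ∑ T, ∫ x in interior (M.tet T), gradInnerAt u v x

/-- The broken form `(div v, p)`, computed tetrahedron by tetrahedron. -/
def divForm (v : E3 → E3) (p : E3 → ℝ) : ℝ :=
  ∑ T, ∫ x in interior (M.tet T), divAt v x * p x

/-- `(u, p)` solves the discrete Stokes equations with right-hand side `f`:
`(∇u, ∇v) - (div v, p) = (f, v)` for all `v ∈ V_h`, and `(div u, q) = 0` for all `q ∈ P_h`. -/
def IsDiscreteStokesSolution (f : Lp E3 2 (volume.restrict Ω))
    (u : M.velocitySpace) (p : M.pressureSpace) : Prop :=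
  (∀ v ∈ M.velocitySpace,
    M.gradForm u v - M.divForm v (p : Lp ℝ 2 (volume.restrict Ω)) =
      ∫ x in Ω, inner ℝ (f x) (v x)) ∧
  (∀ q ∈ M.pressureSpace, M.divForm u q = 0)

end TetMesh

end

/-! Velocity and pressure spaces are finite-dimensional, so the discrete Stokes problem is a square
linear system and existence follows from uniqueness (`existsUnique_saddlePoint`). Two facts suffice:
the broken form (∇u, ∇u) is definite on V_h, and only p = 0 in P_h is orthogonal to all of div V_h.
No stability constant is needed, and the values of the bubbles on the faces play no role.

Both facts come from two properties of the reference bubble. Its divergence is 4x(x - y - z), so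
with barycentric coordinates λ the mapped bubble has divergence 4λ₁(λ₁ - λ₂ - λ₃) on every
tetrahedron, and the nine renumberings yield nine divergences whose orthogonal complement in P₂(T)
is the constants (`exists_eval_eq_const_of_orthogonal`). Moreover, the degree-four parts of the nine
bubbles are linearly independent, so no nontrivial combination of them is cubic
(`bubble_coeff_eq_zero`).

Definiteness (`eq_zero_of_gradForm_self`): if the broken gradient of u vanishes, u is constant on
each open tetrahedron. Its bubble part is then a cubic there, hence zero. What remains is continuous
and piecewise constant, so constant on the connected set closure Ω, and zero because it vanishes at
a boundary point.

Injectivity for the pressure (`eq_zero_of_divForm_eq_zero`): the bubbles force p to be constant on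
each tetrahedron. For tetrahedra sharing a face, the cubic face bubble times a transversal vector is
a conforming P₃ field whose divergence has opposite nonzero integrals over the two, so the two
constants agree (`const_eq_of_face`). Tetrahedra meeting at a point of Ω are linked by short
segments that miss all edges and so change tetrahedra only through faces. Connectedness of Ω makes p
globally constant, and mean value zero makes it vanish. -/

/-! ### Monomial integrals over the corner simplex -/

open Nat in
theorem integral_pow_mul_sub_pow (p q : ℕ) (c : ℝ) :
    ∫ x in (0 : ℝ)..c, x ^ p * (c - x) ^ q =
      (p ! * q ! : ℝ) / ((p + q + 1)! : ℝ) * c ^ (p + q + 1) := by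
  induction p generalizing q with
  | zero =>
    have h : ∫ x in (0 : ℝ)..c, (c - x) ^ q = ∫ x in (0 : ℝ)..c, x ^ q := by
      rw [intervalIntegral.integral_comp_sub_left (fun x => x ^ q) c]
      simp
    simp only [pow_zero, one_mul, h, integral_pow, zero_add, factorial_zero, Nat.factorial_succ]
    have : (q ! : ℝ) ≠ 0 := by exact_mod_cast Nat.factorial_ne_zero q
    push_cast
    field_simp
    simp
  | succ p ih =>
    -- The differentiated product vanishes at both ends, so integration by parts trades a power of x
    -- for a power of c - x; the induction hypothesis is then used at q + 1.
    have hd : ∀ x ∈ Set.uIcc (0 : ℝ) c, HasDerivAt (fun x : ℝ => x ^ (p + 1) * (c - x) ^ (q + 1))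
        ((p + 1 : ℝ) * (x ^ p * (c - x) ^ (q + 1)) - (q + 1 : ℝ) * (x ^ (p + 1) * (c - x) ^ q))
        x := by
      intro x _
      have h1 : HasDerivAt (fun x : ℝ => x ^ (p + 1)) ((p + 1 : ℝ) * x ^ p) x := by
        simpa using hasDerivAt_pow (p + 1) x
      have h2 : HasDerivAt (fun x : ℝ => (c - x) ^ (q + 1)) (-((q + 1 : ℝ) * (c - x) ^ q)) x := by
        exact (((hasDerivAt_id' x).const_sub c).fun_pow (q + 1)).congr_deriv (by simp)
      exact (h1.fun_mul h2).congr_deriv (by ring)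
    have hint := intervalIntegral.integral_eq_sub_of_hasDerivAt hd
      (Continuous.intervalIntegrable (by fun_prop) _ _)
    rw [intervalIntegral.integral_sub (Continuous.intervalIntegrable (by fun_prop) _ _)
      (Continuous.intervalIntegrable (by fun_prop) _ _), intervalIntegral.integral_const_mul,
      intervalIntegral.integral_const_mul, ih] at hint
    have hq : (q + 1 : ℝ) ≠ 0 := by positivity
    have he : (∫ x in (0 : ℝ)..c, x ^ (p + 1) * (c - x) ^ q) = (p + 1 : ℝ) / (q + 1) *
        ((p ! * (q + 1)! : ℝ) / ((p + (q + 1) + 1)! : ℝ) * c ^ (p + (q + 1) + 1)) := by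
      field_simp
      simp only [sub_self, ne_eq, Nat.add_eq_zero_iff, one_ne_zero, and_false, not_false_eq_true,
        zero_pow, mul_zero, zero_mul] at hint
      field_simp at hint
      linarith
    rw [he, show p + 1 + q + 1 = p + (q + 1) + 1 by ring, Nat.factorial_succ p,
      Nat.factorial_succ q]
    push_cast
    field_simp

/-- The open corner simplex of size `c`. -/
def cornerSimplex (n : ℕ) (c : ℝ) : Set (Fin n → ℝ) := {s | (∀ i, 0 < s i) ∧ ∑ i, s i < c}

theorem isOpen_cornerSimplex (n : ℕ) (c : ℝ) : IsOpen (cornerSimplex n c) := by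
  have h : IsOpen {s : Fin n → ℝ | ∑ i, s i < c} := isOpen_lt (by fun_prop) (by fun_prop)
  refine IsOpen.inter (s := {s : Fin n → ℝ | ∀ i, 0 < s i}) ?_ h
  simp only [Set.ofPred_forall]
  exact isOpen_iInter_of_finite fun i => isOpen_lt (by fun_prop) (by fun_prop)

theorem cornerSimplex_subset_Icc (n : ℕ) (c : ℝ) :
    cornerSimplex n c ⊆ Set.Icc 0 (fun _ => c) := by
  rintro s ⟨h0, h1⟩
  refine ⟨fun i => (h0 i).le, fun i => ?_⟩
  exact (Finset.single_le_sum (fun j _ => (h0 j).le) (Finset.mem_univ i)).trans h1.le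

theorem Continuous.integrableOn_cornerSimplex {n : ℕ} {c : ℝ} {g : (Fin n → ℝ) → ℝ}
    (hg : Continuous g) : IntegrableOn g (cornerSimplex n c) :=
  (hg.continuousOn.integrableOn_compact isCompact_Icc).mono_set (cornerSimplex_subset_Icc n c)

theorem cornerSimplex_of_nonpos {n : ℕ} {c : ℝ} (hc : c ≤ 0) : cornerSimplex n c = ∅ := by
  ext s
  simp only [cornerSimplex, Set.mem_ofPred_eq, Set.mem_empty_iff_false, iff_false, not_and, not_lt]
  exact fun h => hc.trans (Finset.sum_nonneg fun i _ => (h i).le)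

-- Fixing the first coordinate x leaves a corner simplex of size c - x, hence the general c in the
-- induction; the outer integral is a beta integral.
open Nat in
theorem integral_monomial_cornerSimplex (n : ℕ) (e : Fin n → ℕ) {c : ℝ} (hc : 0 < c) :
    ∫ s in cornerSimplex n c, ∏ i, s i ^ e i =
      (∏ i, ((e i)! : ℝ)) / ((∑ i, e i + n)! : ℝ) * c ^ (∑ i, e i + n) := by
  induction n generalizing c with
  | zero =>
    have : cornerSimplex 0 c = Set.univ := by
      ext s; simp [cornerSimplex, hc]
    simp [this, measureReal_def, volume_pi]
  | succ n ih =>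
    set f : (Fin (n + 1) → ℝ) → ℝ := fun s => ∏ i, s i ^ e i with hf
    set A := cornerSimplex (n + 1) c with hA
    have hAm : MeasurableSet A := (isOpen_cornerSimplex _ _).measurableSet
    have hfc : Continuous f := by fun_prop
    have hint : Integrable (A.indicator f) := by
      rw [integrable_indicator_iff hAm]
      exact hfc.integrableOn_cornerSimplex
    have mp := (volume_preserving_piFinSuccAbove (fun _ : Fin (n + 1) => ℝ) 0).symm
    have hcons : ∀ p : ℝ × (Fin n → ℝ),
        (MeasurableEquiv.piFinSuccAbove (fun _ : Fin (n + 1) => ℝ) 0).symm p =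
          (Fin.cons p.1 p.2 : Fin (n + 1) → ℝ) := fun p => by
      simp [MeasurableEquiv.piFinSuccAbove, Fin.consEquiv]
    have h1 : ∫ s in A, f s = ∫ p : ℝ × (Fin n → ℝ), A.indicator f (Fin.cons p.1 p.2) := by
      rw [← integral_indicator hAm, ← mp.integral_comp']
      simp_rw [hcons]
    have hint' : Integrable (fun p : ℝ × (Fin n → ℝ) => A.indicator f (Fin.cons p.1 p.2)) :=
      (mp.integrable_comp_of_integrable hint).congr
        (.of_forall fun p => congrArg (A.indicator f) (hcons p))
    rw [h1, Measure.volume_eq_prod, integral_prod _ hint']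
    set N := ∑ i : Fin n, e i.succ + n with hN
    set K : ℝ := (∏ i : Fin n, ((e i.succ)! : ℝ)) / (N ! : ℝ) with hK
    have h2 : ∀ x : ℝ, ∫ t : Fin n → ℝ, A.indicator f (Fin.cons x t) =
        (Set.Ioo 0 c).indicator (fun x => K * (x ^ e 0 * (c - x) ^ N)) x := by
      intro x
      by_cases hx : 0 < x
      · have h3 : ∀ t : Fin n → ℝ, A.indicator f (Fin.cons x t) =
            x ^ e 0 * (cornerSimplex n (c - x)).indicator (fun t => ∏ i, t i ^ e i.succ) t := by
          intro t
          have hmem : (Fin.cons x t : Fin (n + 1) → ℝ) ∈ A ↔ t ∈ cornerSimplex n (c - x) := by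
            simp only [hA, cornerSimplex, Set.mem_ofPred_eq, Fin.forall_fin_succ, Fin.cons_zero,
              Fin.cons_succ, Fin.sum_univ_succ, hx, true_and, lt_sub_iff_add_lt']
          by_cases ht : t ∈ cornerSimplex n (c - x)
          · rw [Set.indicator_of_mem ht, Set.indicator_of_mem (hmem.2 ht)]
            simp [hf, Fin.prod_univ_succ]
          · rw [Set.indicator_of_notMem ht, Set.indicator_of_notMem (mt hmem.1 ht), mul_zero]
        simp_rw [h3]
        rw [integral_const_mul, integral_indicator (isOpen_cornerSimplex _ _).measurableSet]
        -- For x ≥ c the slice is empty, and the induction hypothesis is only available for positive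
        -- size.
        by_cases hxc : x < c
        · rw [ih (fun i => e i.succ) (sub_pos.2 hxc), Set.indicator_of_mem (Set.mem_Ioo.2 ⟨hx, hxc⟩)]
          ring
        · rw [cornerSimplex_of_nonpos (by linarith), Set.indicator_of_notMem (by simp [hxc])]
          simp
      · rw [Set.indicator_of_notMem (by simp [hx])]
        have : ∀ t : Fin n → ℝ, A.indicator f (Fin.cons x t) = 0 := fun t =>
          Set.indicator_of_notMem (fun h => hx (by simpa using h.1 0)) _
        simp [this]
    simp_rw [h2]
    rw [integral_indicator measurableSet_Ioo, ← integral_Ioc_eq_integral_Ioo,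
      ← intervalIntegral.integral_of_le hc.le, intervalIntegral.integral_const_mul,
      integral_pow_mul_sub_pow, Fin.prod_univ_succ, Fin.sum_univ_succ,
      show e 0 + ∑ i : Fin n, e i.succ + (n + 1) = e 0 + N + 1 by omega, hK]
    have : (N ! : ℝ) ≠ 0 := by exact_mod_cast Nat.factorial_ne_zero N
    field_simp

/-! ### Barycentric coordinates and the affine parametrization of a tetrahedron -/

/-- Four affinely independent points of space as an affine basis. -/
noncomputable def AffineIndependent.tetBasis {a : Fin 4 → E3} (h : AffineIndependent ℝ a) :
    AffineBasis (Fin 4) ℝ E3 where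
  toFun := a
  ind' := h
  tot' := by
    rw [h.affineSpan_eq_top_iff_card_eq_finrank_add_one]
    simp

namespace AffineBasis

variable (b : AffineBasis (Fin 4) ℝ E3)

theorem coord_linear_sub (m k l : Fin 4) :
    (b.coord m).linear (b k - b l) = (if m = k then 1 else 0) - (if m = l then 1 else 0) := by
  rw [← vsub_eq_sub, AffineMap.linearMap_vsub, b.coord_apply, b.coord_apply, vsub_eq_sub]

theorem coord_add_vec (m : Fin 4) (x w : E3) :
    b.coord m (x + w) = b.coord m x + (b.coord m).linear w := by
  have := (b.coord m).map_vadd x w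
  simpa [add_comm] using this

theorem eq_add_sum_coord (x : E3) :
    x = b 0 + ∑ k : Fin 3, b.coord k.succ x • (b k.succ - b 0) := by
  have h := b.linear_combination_coord_eq_self x
  have h1 := b.sum_coord_apply_eq_one x
  rw [Fin.sum_univ_succ] at h h1
  conv_lhs => rw [← h]
  simp only [smul_sub, Finset.sum_sub_distrib, ← Finset.sum_smul]
  rw [eq_sub_of_add_eq h1]
  module

/-- The affine parametrization of space by the corner simplex. -/
noncomputable def param (s : Fin 3 → ℝ) : E3 := b 0 + ∑ k : Fin 3, s k • (b k.succ - b 0)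

theorem coord_param (s : Fin 3 → ℝ) (k : Fin 3) : b.coord k.succ (b.param s) = s k := by
  rw [param, coord_add_vec, map_sum, b.coord_apply_ne (Fin.succ_ne_zero k)]
  simp only [map_smul, coord_linear_sub, Fin.succ_inj, Fin.succ_ne_zero]
  simp

theorem coord_zero_param (s : Fin 3 → ℝ) : b.coord 0 (b.param s) = 1 - ∑ k, s k := by
  have h1 := b.sum_coord_apply_eq_one (b.param s)
  rw [Fin.sum_univ_succ] at h1
  simp only [coord_param] at h1
  linarith

theorem param_eq (s : Fin 3 → ℝ) :
    b.param s = WithLp.toLp 2 (Matrix.mulVec (jacobiMatrix b) s) + b 0 := by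
  ext m
  simp only [param, PiLp.add_apply, WithLp.ofLp_sum, WithLp.ofLp_smul, WithLp.ofLp_sub,
    Finset.sum_apply, Pi.smul_apply, Pi.sub_apply, smul_eq_mul, Matrix.mulVec, dotProduct,
    jacobiMatrix, Matrix.of_apply]
  rw [add_comm]
  congr 1
  exact Finset.sum_congr rfl fun k _ => mul_comm _ _

theorem param_coord (x : E3) : b.param (fun k => b.coord k.succ x) = x :=
  (b.eq_add_sum_coord x).symm

/-- A kernel vector would be a second parameter for the image of 0, but the barycentric coordinates
recover the parameter. -/
theorem det_jacobiMatrix_ne_zero : (jacobiMatrix b).det ≠ 0 := by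
  intro h0
  obtain ⟨v, hv, hv0⟩ := Matrix.exists_mulVec_eq_zero_iff.2 h0
  apply hv
  have h : b.param v = b.param 0 := by rw [param_eq, param_eq, hv0, Matrix.mulVec_zero]
  ext k
  rw [← b.coord_param v k, h, coord_param]

theorem inv_jacobiMatrix_mulVec (x : E3) :
    Matrix.mulVec (jacobiMatrix b)⁻¹ (WithLp.ofLp (x - b 0)) = fun k => b.coord k.succ x := by
  have hJ : IsUnit (jacobiMatrix b).det := isUnit_iff_ne_zero.2 b.det_jacobiMatrix_ne_zero
  have h : WithLp.ofLp (x - b 0) =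
      Matrix.mulVec (jacobiMatrix b) (fun k => b.coord k.succ x) := by
    conv_lhs => rw [← b.param_coord x, param_eq]
    simp
  rw [h, Matrix.mulVec_mulVec, Matrix.nonsing_inv_mul _ hJ, Matrix.one_mulVec]

/-- Expanding in the edge vectors at vertex 0 removes the inverse matrix: the coefficients are the
reference polynomials evaluated at barycentric coordinates. -/
theorem mappedBubble_eq (x : E3) : mappedBubble b x =
    ∑ k : Fin 3, refBubble (fun j => b.coord j.succ x) k • (b k.succ - b 0) := by
  rw [mappedBubble, inv_jacobiMatrix_mulVec]
  have h := b.param_eq (refBubble fun j => b.coord j.succ x)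
  rw [param, add_comm] at h
  exact (add_right_cancel h).symm

theorem continuous_coord' (i : Fin 4) : Continuous (b.coord i) :=
  (b.coord i).continuous_of_finiteDimensional

theorem contDiff_coord {n : WithTop ℕ∞} (i : Fin 4) : ContDiff ℝ n (b.coord i) := by
  have h : (b.coord i : E3 → ℝ) = fun x => (LinearMap.toContinuousLinearMap (b.coord i).linear) x
      + b.coord i 0 := by
    ext x
    simpa using b.coord_add_vec i 0 x |>.trans (add_comm _ _)
  rw [h]
  fun_prop

theorem continuous_param : Continuous b.param := by
  unfold param
  fun_prop

theorem param_mem_interior (s : Fin 3 → ℝ) :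
    b.param s ∈ interior (convexHull ℝ (Set.range b)) ↔ s ∈ cornerSimplex 3 1 := by
  rw [b.interior_convexHull]
  simp only [Set.mem_ofPred_eq, cornerSimplex, Fin.forall_fin_succ (n := 3), coord_zero_param,
    coord_param, sub_pos]
  exact and_comm

theorem map_param_volume :
    Measure.map b.param volume = ENNReal.ofReal |(jacobiMatrix b).det⁻¹| • (volume : Measure E3) := by
  have h : b.param = (fun x : E3 => x + b 0) ∘ (WithLp.toLp 2) ∘ (Matrix.toLin' (jacobiMatrix b)) := by
    ext1 s
    rw [param_eq]
    rfl
  have m1 : Measurable (Matrix.toLin' (jacobiMatrix b)) :=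
    (LinearMap.continuous_of_finiteDimensional _).measurable
  have m2 := PiLp.volume_preserving_toLp (Fin 3)
  have m3 : Measurable fun x : E3 => x + b 0 := by fun_prop
  rw [h, ← Measure.map_map m3 (m2.measurable.comp m1), ← Measure.map_map m2.measurable m1,
    Real.map_matrix_volume_pi_eq_smul_volume_pi b.det_jacobiMatrix_ne_zero, Measure.map_smul,
    m2.map_eq, Measure.map_smul, map_add_right_eq_self]

theorem setIntegral_interior_convexHull {g : E3 → ℝ} (hg : Continuous g) :
    ∫ x in interior (convexHull ℝ (Set.range b)), g x =
      |(jacobiMatrix b).det| * ∫ s in cornerSimplex 3 1, g (b.param s) := by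
  set A := interior (convexHull ℝ (Set.range b)) with hA
  have hAm : MeasurableSet A := isOpen_interior.measurableSet
  have hd : |(jacobiMatrix b).det| ≠ 0 := abs_ne_zero.2 b.det_jacobiMatrix_ne_zero
  have h1 : ∫ s, A.indicator g (b.param s) = |(jacobiMatrix b).det|⁻¹ * ∫ x in A, g x := by
    rw [← integral_indicator hAm, ← integral_map (φ := b.param)
      b.continuous_param.measurable.aemeasurable, map_param_volume, integral_smul_measure,
      ENNReal.toReal_ofReal (abs_nonneg _), abs_inv, smul_eq_mul]
    exact (hg.measurable.indicator hAm).aestronglyMeasurable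
  have h2 : ∫ s, A.indicator g (b.param s) = ∫ s in cornerSimplex 3 1, g (b.param s) := by
    rw [← integral_indicator (isOpen_cornerSimplex 3 1).measurableSet]
    refine integral_congr_ae (.of_forall fun s => ?_)
    by_cases hs : s ∈ cornerSimplex 3 1
    · simp only [Set.indicator_of_mem hs]
      exact Set.indicator_of_mem ((b.param_mem_interior s).2 hs) _
    · simp only [Set.indicator_of_notMem hs]
      exact Set.indicator_of_notMem (mt (b.param_mem_interior s).1 hs) _
  rw [← h2, h1, mul_inv_cancel_left₀ hd]

end AffineBasis

open Nat in
theorem integral_monomial_refTet (i j k : ℕ) :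
    ∫ s in cornerSimplex 3 1, s 0 ^ i * s 1 ^ j * s 2 ^ k =
      (i ! * j ! * k ! : ℝ) / ((i + j + k + 3)! : ℝ) := by
  have h := integral_monomial_cornerSimplex 3 ![i, j, k] one_pos
  simpa [Fin.prod_univ_three, Fin.sum_univ_three] using h

-- A polynomial is entered as a table of coefficients and exponents, so that the concrete integrals
-- below reduce to arithmetic with factorials.
open Nat in
theorem integral_sum_monomials_refTet (l : List (ℝ × ℕ × ℕ × ℕ)) :
    ∫ s in cornerSimplex 3 1,
        (l.map fun t => t.1 * (s 0 ^ t.2.1 * s 1 ^ t.2.2.1 * s 2 ^ t.2.2.2)).sum =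
      (l.map fun t => t.1 * ((t.2.1 ! * t.2.2.1 ! * t.2.2.2 ! : ℝ) /
        ((t.2.1 + t.2.2.1 + t.2.2.2 + 3)! : ℝ))).sum := by
  induction l with
  | nil => simp
  | cons t l ih =>
    simp only [List.map_cons, List.sum_cons]
    rw [integral_add (Continuous.integrableOn_cornerSimplex (by fun_prop))
      (Continuous.integrableOn_cornerSimplex ?_), ih, integral_const_mul, integral_monomial_refTet]
    clear ih
    induction l with
    | nil => simpa using continuous_const
    | cons t l ih =>
      simp only [List.map_cons, List.sum_cons]
      exact Continuous.add (by fun_prop) ih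

/-! ### Divergence of the bubbles -/

theorem hasDerivAt_quartic {f : ℝ → ℝ} {c₀ c₁ c₂ c₃ c₄ : ℝ}
    (hf : ∀ x, f x = c₀ + c₁ * x + c₂ * x ^ 2 + c₃ * x ^ 3 + c₄ * x ^ 4) (x : ℝ) :
    HasDerivAt f (c₁ + 2 * c₂ * x + 3 * c₃ * x ^ 2 + 4 * c₄ * x ^ 3) x := by
  have h : f = fun x => c₀ + c₁ * x + c₂ * x ^ 2 + c₃ * x ^ 3 + c₄ * x ^ 4 := funext hf
  rw [h]
  exact (((((hasDerivAt_id' x).const_mul c₁).const_add c₀).fun_add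
    ((hasDerivAt_pow 2 x).const_mul c₂)).fun_add ((hasDerivAt_pow 3 x).const_mul c₃)).fun_add
    ((hasDerivAt_pow 4 x).const_mul c₄) |>.congr_deriv (by norm_num; ring)

/-- The divergence of the reference bubble is a quadratic polynomial. -/
theorem deriv_refBubble_sum (x y z : ℝ) :
    deriv (fun t => refBubble1 t y z) x + deriv (fun t => refBubble2 x t z) y
      + deriv (fun t => refBubble3 x y t) z = 4 * x * (x - y - z) := by
  -- In each of the three cases the polynomial is sorted by powers of the variable being
  -- differentiated, the others being parameters.
  have h1 := hasDerivAt_quartic (f := fun t => refBubble1 t y z)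
    (c₄ := 263 / 12) (c₃ := 38 * y + 265 / 3 * z - 253 / 6)
    (c₂ := 29 * y ^ 2 + 96 * y * z + 209 / 2 * z ^ 2 - 87 / 2 * y - 119 * z + 703 / 28)
    (c₁ := -16 * y ^ 3 + 42 * y ^ 2 * z + 42 * y * z ^ 2 + 103 / 3 * z ^ 3 + 21 / 2 * y ^ 2
      - 56 * y * z - 65 * z ^ 2 + 7 / 2 * y + 251 / 7 * z - 181 / 42)
    (c₀ := refBubble1 0 y z) (fun t => by simp only [refBubble1]; ring) x
  have h2 := hasDerivAt_quartic (f := fun t => refBubble2 x t z)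
    (c₄ := 0) (c₃ := -(203 / 3) * x - 64 / 3 * z + 79 / 8)
    (c₂ := -(233 / 2) * x ^ 2 - 225 * x * z - 21 * z ^ 2 + 1025 / 8 * x + 417 / 8 * z - 447 / 28)
    (c₁ := -(233 / 3) * x ^ 3 - 235 * x ^ 2 * z - 209 * x * z ^ 2 - 16 / 3 * z ^ 3
      + 1105 / 8 * x ^ 2 + 1077 / 4 * x * z + 289 / 8 * z ^ 2 - 505 / 7 * x - 251 / 7 * z + 625 / 84)
    (c₀ := refBubble2 x 0 z) (fun t => by simp only [refBubble2]; ring) y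
  have h3 := hasDerivAt_quartic (f := fun t => refBubble3 x y t)
    (c₄ := -(29 / 4)) (c₃ := 77 / 8)
    (c₂ := -15 * x ^ 2 + 129 * x * y + 11 * y ^ 2 - 141 / 8 * x - 193 / 8 * y)
    (c₁ := -10 * x ^ 3 + 119 * x ^ 2 * y + 145 * x * y ^ 2 + 16 * y ^ 3 - 61 / 8 * x ^ 2
      - 693 / 4 * x * y - 321 / 8 * y ^ 2 + 307 / 14 * x + 199 / 7 * y - 263 / 84)
    (c₀ := refBubble3 x y 0) (fun t => by simp only [refBubble3]; ring) z
  -- All cubic, linear and constant terms of the three derivatives cancel in the sum.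
  rw [h1.deriv, h2.deriv, h3.deriv]
  ring

theorem contDiff_refBubble {n : WithTop ℕ∞} (k : Fin 3) :
    ContDiff ℝ n (fun s : Fin 3 → ℝ => refBubble s k) := by
  fin_cases k
  · change ContDiff ℝ n (fun s : Fin 3 → ℝ => refBubble1 (s 0) (s 1) (s 2))
    unfold refBubble1
    fun_prop
  · change ContDiff ℝ n (fun s : Fin 3 → ℝ => refBubble2 (s 0) (s 1) (s 2))
    unfold refBubble2
    fun_prop
  · change ContDiff ℝ n (fun s : Fin 3 → ℝ => refBubble3 (s 0) (s 1) (s 2))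
    unfold refBubble3
    fun_prop

/-- The divergence is the trace of the derivative, and the rank-one map φ'(x) ⊗ w has trace φ'(x) w.
This permits derivatives along edges instead of coordinate axes. -/
theorem divAt_sum_smul {ι : Type*} [Fintype ι] {φ : ι → E3 → ℝ} {w : ι → E3} {x : E3}
    (hφ : ∀ k, DifferentiableAt ℝ (φ k) x) :
    divAt (fun y => ∑ k, φ k y • w k) x = ∑ k, fderiv ℝ (φ k) x (w k) := by
  have h : HasFDerivAt (fun y => ∑ k, φ k y • w k)
      (∑ k, (fderiv ℝ (φ k) x).smulRight (w k)) x :=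
    HasFDerivAt.fun_sum fun k _ => (hφ k).hasFDerivAt.smul_const (w k)
  rw [divAt, h.fderiv]
  simp only [sum_apply, ContinuousLinearMap.smulRight_apply, WithLp.ofLp_sum,
    WithLp.ofLp_smul, Finset.sum_apply, Pi.smul_apply, smul_eq_mul]
  rw [Finset.sum_comm]
  refine Finset.sum_congr rfl fun k _ => ?_
  have hw : w k = ∑ j, w k j • EuclideanSpace.single j (1 : ℝ) := by
    ext m
    simp [Pi.single_apply]
  conv_rhs => rw [hw, map_sum]
  simp [mul_comm]

namespace AffineBasis

variable (b : AffineBasis (Fin 4) ℝ E3)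

theorem coord_add_smul_sub (m k l : Fin 4) (x : E3) (t : ℝ) :
    b.coord m (x + t • (b k - b l)) =
      b.coord m x + t * ((if m = k then 1 else 0) - (if m = l then 1 else 0)) := by
  rw [coord_add_vec, map_smul, coord_linear_sub, smul_eq_mul]

theorem contDiff_refBubble_coord {n : WithTop ℕ∞} (k : Fin 3) :
    ContDiff ℝ n (fun x => refBubble (fun j => b.coord j.succ x) k) :=
  ContDiff.comp (g := fun s : Fin 3 → ℝ => refBubble s k) (f := fun x j => b.coord j.succ x)
    (contDiff_refBubble k) (contDiff_pi.2 fun _ => b.contDiff_coord _)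

theorem contDiff_mappedBubble {n : WithTop ℕ∞} : ContDiff ℝ n (mappedBubble b) := by
  have h : mappedBubble b = fun x =>
      ∑ k : Fin 3, refBubble (fun j => b.coord j.succ x) k • (b k.succ - b 0) :=
    funext b.mappedBubble_eq
  rw [h]
  refine ContDiff.sum fun k _ => ContDiff.fun_smul ?_ contDiff_const
  exact b.contDiff_refBubble_coord k

/-- Along the edge from vertex 0 to vertex k, coordinate k grows at unit rate and the other two of
the coordinates 1, 2, 3 stay fixed. The edge derivatives are thus the reference partial derivatives,
and no Jacobian factor appears. -/
theorem divAt_mappedBubble (x : E3) : divAt (mappedBubble b) x =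
    4 * b.coord 1 x * (b.coord 1 x - b.coord 2 x - b.coord 3 x) := by
  have h : mappedBubble b = fun x =>
      ∑ k : Fin 3, refBubble (fun j => b.coord j.succ x) k • (b k.succ - b 0) :=
    funext b.mappedBubble_eq
  have hd : ∀ k : Fin 3, DifferentiableAt ℝ (fun x => refBubble (fun j => b.coord j.succ x) k) x :=
    fun k => ((b.contDiff_refBubble_coord (n := 1) k).differentiable (by simp)).differentiableAt
  rw [h, divAt_sum_smul hd]
  simp_rw [← (hd _).lineDeriv_eq_fderiv, lineDeriv, coord_add_smul_sub]
  have hs (f : ℝ → ℝ) (c : ℝ) : deriv f c = deriv (fun t => f (c + t)) 0 := by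
    rw [deriv_comp_const_add, add_zero]
  rw [Fin.sum_univ_three, ← deriv_refBubble_sum, hs _ (b.coord 1 x), hs _ (b.coord 2 x),
    hs _ (b.coord 3 x)]
  simp [refBubble, show (0 : Fin 3).succ = (1 : Fin 4) from rfl,
    show (1 : Fin 3).succ = (2 : Fin 4) from rfl, show (2 : Fin 3).succ = (3 : Fin 4) from rfl]

end AffineBasis

/-! ### Testing quadratic polynomials against the divergences -/

theorem integral_refDiv_mul_quadratic (q₀ q₁ q₂ q₃ q₄ q₅ q₆ q₇ q₈ q₉ : ℝ) :
    ∫ s in cornerSimplex 3 1, 4 * s 0 * (s 0 - s 1 - s 2) * (q₀ + q₁ * s 0 + q₂ * s 1 + q₃ * s 2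
      + q₄ * s 0 ^ 2 + q₅ * (s 0 * s 1) + q₆ * (s 0 * s 2) + q₇ * s 1 ^ 2 + q₈ * (s 1 * s 2)
      + q₉ * s 2 ^ 2) =
      q₁ / 90 - q₂ / 180 - q₃ / 180 + q₄ / 105 - q₇ / 315 - q₈ / 630 - q₉ / 315 := by
  have h := integral_sum_monomials_refTet
    -- The three blocks of ten terms are the products of the quadratic with 4x², -4xy and -4xz.
    [(4 * q₀, 2, 0, 0), (4 * q₁, 3, 0, 0), (4 * q₂, 2, 1, 0), (4 * q₃, 2, 0, 1), (4 * q₄, 4, 0, 0),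
      (4 * q₅, 3, 1, 0), (4 * q₆, 3, 0, 1), (4 * q₇, 2, 2, 0), (4 * q₈, 2, 1, 1), (4 * q₉, 2, 0, 2),
      (-4 * q₀, 1, 1, 0), (-4 * q₁, 2, 1, 0), (-4 * q₂, 1, 2, 0), (-4 * q₃, 1, 1, 1),
      (-4 * q₄, 3, 1, 0), (-4 * q₅, 2, 2, 0), (-4 * q₆, 2, 1, 1), (-4 * q₇, 1, 3, 0),
      (-4 * q₈, 1, 2, 1), (-4 * q₉, 1, 1, 2),
      (-4 * q₀, 1, 0, 1), (-4 * q₁, 2, 0, 1), (-4 * q₂, 1, 1, 1), (-4 * q₃, 1, 0, 2),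
      (-4 * q₄, 3, 0, 1), (-4 * q₅, 2, 1, 1), (-4 * q₆, 2, 0, 2), (-4 * q₇, 1, 2, 1),
      (-4 * q₈, 1, 1, 2), (-4 * q₉, 1, 0, 3)]
  simp only [List.map_cons, List.map_nil, List.sum_cons, List.sum_nil] at h
  refine Eq.trans (integral_congr_ae (.of_forall fun s => ?_)) (h.trans ?_)
  · simp only []
    ring
  · norm_num [Nat.factorial]
    ring

/-- Polynomials of degree at most two are quadratic forms in the barycentric coordinates. -/
theorem AffineBasis.exists_quadraticForm_coord (b : AffineBasis (Fin 4) ℝ E3)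
    {q : MvPolynomial (Fin 3) ℝ} (hq : q ∈ MvPolynomial.restrictTotalDegree (Fin 3) ℝ 2) :
    ∃ C : Fin 4 → Fin 4 → ℝ, ∀ x : E3, MvPolynomial.eval (fun k => x k) q =
      ∑ k, ∑ l, C k l * (b.coord k x * b.coord l x) := by
  have hx : ∀ (x : E3) (m : Fin 3), x m = ∑ k, b.coord k x * b k m := fun x m => by
    have h := congrArg (fun y : E3 => y m) (b.linear_combination_coord_eq_self x)
    simp only [WithLp.ofLp_sum, WithLp.ofLp_smul, Finset.sum_apply, Pi.smul_apply,
      smul_eq_mul] at h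
    exact h.symm
  have h1 : ∀ x : E3, 1 = ∑ k, b.coord k x * 1 := fun x => by
    simp [b.sum_coord_apply_eq_one x]
  have hprod : ∀ f g : E3 → ℝ, (∃ α : Fin 4 → ℝ, ∀ x, f x = ∑ k, b.coord k x * α k) →
      (∃ β : Fin 4 → ℝ, ∀ x, g x = ∑ k, b.coord k x * β k) →
      ∃ C : Fin 4 → Fin 4 → ℝ, ∀ x, f x * g x =
        ∑ k, ∑ l, C k l * (b.coord k x * b.coord l x) := by
    rintro f g ⟨α, hα⟩ ⟨β, hβ⟩
    refine ⟨fun k l => α k * β l, fun x => ?_⟩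
    rw [hα, hβ, Finset.sum_mul_sum]
    exact Finset.sum_congr rfl fun k _ => Finset.sum_congr rfl fun l _ => by ring
  have hv : ∀ m : Fin 3, ∃ α : Fin 4 → ℝ, ∀ x : E3, x m = ∑ k, b.coord k x * α k :=
    fun m => ⟨_, fun x => hx x m⟩
  have hone : ∃ α : Fin 4 → ℝ, ∀ x : E3, (1 : ℝ) = ∑ k, b.coord k x * α k := ⟨_, h1⟩
  have hmon : ∀ s : Fin 3 →₀ ℕ, s 0 + s 1 + s 2 ≤ 2 → ∃ C : Fin 4 → Fin 4 → ℝ, ∀ x : E3,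
      x 0 ^ s 0 * x 1 ^ s 1 * x 2 ^ s 2 = ∑ k, ∑ l, C k l * (b.coord k x * b.coord l x) := by
    intro s hs
    -- A monomial of degree at most two is a product of two factors taken from 1 and the
    -- coordinates. The factor 1 counts as the sum of the barycentric coordinates, which homogenizes
    -- the lower degrees.
    have key : ∃ f g : E3 → ℝ, (∃ α : Fin 4 → ℝ, ∀ x, f x = ∑ k, b.coord k x * α k) ∧
        (∃ β : Fin 4 → ℝ, ∀ x, g x = ∑ k, b.coord k x * β k) ∧
        ∀ x, x 0 ^ s 0 * x 1 ^ s 1 * x 2 ^ s 2 = f x * g x := by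
      generalize s 0 = i at *
      generalize s 1 = j at *
      generalize s 2 = k at *
      have hi : i ≤ 2 := by omega
      have hj : j ≤ 2 := by omega
      have hk : k ≤ 2 := by omega
      interval_cases i <;> interval_cases j <;> interval_cases k <;> try omega
      · exact ⟨_, _, hone, hone, fun x => by ring⟩
      · exact ⟨_, _, hone, hv 2, fun x => by ring⟩
      · exact ⟨_, _, hv 2, hv 2, fun x => by ring⟩
      · exact ⟨_, _, hone, hv 1, fun x => by ring⟩
      · exact ⟨_, _, hv 1, hv 2, fun x => by ring⟩
      · exact ⟨_, _, hv 1, hv 1, fun x => by ring⟩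
      · exact ⟨_, _, hone, hv 0, fun x => by ring⟩
      · exact ⟨_, _, hv 0, hv 2, fun x => by ring⟩
      · exact ⟨_, _, hv 0, hv 1, fun x => by ring⟩
      · exact ⟨_, _, hv 0, hv 0, fun x => by ring⟩
    obtain ⟨f, g, hf, hg, h⟩ := key
    obtain ⟨C, hC⟩ := hprod f g hf hg
    exact ⟨C, fun x => (h x).trans (hC x)⟩
  rw [MvPolynomial.mem_restrictTotalDegree] at hq
  have hs : ∀ s ∈ q.support, s 0 + s 1 + s 2 ≤ 2 := fun s hs => by
    have := (MvPolynomial.le_totalDegree hs).trans hq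
    rwa [Finsupp.sum_fintype _ _ (fun _ => rfl), Fin.sum_univ_three] at this
  choose! C hC using hmon
  refine ⟨fun k l => ∑ s ∈ q.support, MvPolynomial.coeff s q * C s k l, fun x => ?_⟩
  rw [MvPolynomial.eval_eq']
  simp_rw [Fin.prod_univ_three]
  rw [Finset.sum_congr rfl fun s h => by rw [hC s (hs s h) x]]
  simp_rw [Finset.mul_sum, Finset.sum_mul]
  rw [Finset.sum_comm]
  refine Finset.sum_congr rfl fun k _ => ?_
  rw [Finset.sum_comm]
  exact Finset.sum_congr rfl fun l _ => Finset.sum_congr rfl fun s _ => by ring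

theorem renumbering_bijective (i : Fin 9) : Function.Bijective (renumbering i) := by
  rw [← Finite.injective_iff_bijective]
  revert i
  decide

namespace AffineBasis

variable (b : AffineBasis (Fin 4) ℝ E3)

/-- The basis whose points are those of `b` in the order given by a bijection. -/
noncomputable def renumber {σ : Fin 4 → Fin 4} (hσ : Function.Bijective σ) :
    AffineBasis (Fin 4) ℝ E3 :=
  b.reindex (Equiv.ofBijective σ hσ).symm

theorem coe_renumber {σ : Fin 4 → Fin 4} (hσ : Function.Bijective σ) :
    ⇑(b.renumber hσ) = fun k => b (σ k) := rfl

theorem coord_renumber {σ : Fin 4 → Fin 4} (hσ : Function.Bijective σ) (k : Fin 4) :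
    (b.renumber hσ).coord k = b.coord (σ k) := by
  rw [renumber, coord_reindex]
  rfl

theorem range_renumber {σ : Fin 4 → Fin 4} (hσ : Function.Bijective σ) :
    Set.range (b.renumber hσ) = Set.range b := by
  rw [coe_renumber]
  exact hσ.surjective.range_comp b

/-- This is one fixed linear functional of `C`, up to a nonzero factor. Renumbering the vertices
permutes the indices of `C`, so this single integral supplies all nine equations. -/
theorem setIntegral_divAt_mappedBubble_mul (C : Fin 4 → Fin 4 → ℝ) :
    ∫ x in interior (convexHull ℝ (Set.range b)), divAt (mappedBubble b) x *
        ∑ k, ∑ l, C k l * (b.coord k x * b.coord l x) =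
      |(jacobiMatrix b).det| * ((C 0 1 + C 1 0) / 630 - (C 0 2 + C 2 0 + C 0 3 + C 3 0) / 1260
        + C 1 1 / 105 - (C 2 2 + C 3 3) / 315 - (C 2 3 + C 3 2) / 630) := by
  simp_rw [divAt_mappedBubble]
  have hc := b.continuous_coord'
  rw [setIntegral_interior_convexHull b (by fun_prop)]
  congr 1
  have h0 := b.coord_zero_param
  have h1 : ∀ s, b.coord 1 (b.param s) = s 0 := fun s => b.coord_param s 0
  have h2 : ∀ s, b.coord 2 (b.param s) = s 1 := fun s => b.coord_param s 1
  have h3 : ∀ s, b.coord 3 (b.param s) = s 2 := fun s => b.coord_param s 2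
  -- The arguments are the coefficients of the quadratic form after substituting λ₀ = 1 - s₀ - s₁ -
  -- s₂.
  have key := integral_refDiv_mul_quadratic (C 0 0)
    (C 0 1 + C 1 0 - 2 * C 0 0) (C 0 2 + C 2 0 - 2 * C 0 0) (C 0 3 + C 3 0 - 2 * C 0 0)
    (C 0 0 - C 0 1 - C 1 0 + C 1 1)
    (2 * C 0 0 - C 0 1 - C 1 0 - C 0 2 - C 2 0 + C 1 2 + C 2 1)
    (2 * C 0 0 - C 0 1 - C 1 0 - C 0 3 - C 3 0 + C 1 3 + C 3 1)
    (C 0 0 - C 0 2 - C 2 0 + C 2 2)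
    (2 * C 0 0 - C 0 2 - C 2 0 - C 0 3 - C 3 0 + C 2 3 + C 3 2)
    (C 0 0 - C 0 3 - C 3 0 + C 3 3)
  refine Eq.trans (integral_congr_ae (.of_forall fun s => ?_)) (key.trans ?_)
  · simp only [Fin.sum_univ_four, h0, h1, h2, h3, Fin.sum_univ_three]
    ring
  · ring

/-- A quadratic polynomial that is orthogonal to the divergences of the nine bubbles of a
tetrahedron is constant. -/
theorem exists_eval_eq_const_of_orthogonal
    {q : MvPolynomial (Fin 3) ℝ} (hq : q ∈ MvPolynomial.restrictTotalDegree (Fin 3) ℝ 2)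
    (h : ∀ i, ∫ x in interior (convexHull ℝ (Set.range b)),
      divAt (mappedBubble fun k => b (renumbering i k)) x * MvPolynomial.eval (fun k => x k) q = 0) :
    ∃ c, ∀ x : E3, MvPolynomial.eval (fun k => x k) q = c := by
  obtain ⟨C, hC⟩ := b.exists_quadraticForm_coord hq
  have key : ∀ i, (fun D : Fin 4 → Fin 4 → ℝ => (D 0 1 + D 1 0) / 630
      - (D 0 2 + D 2 0 + D 0 3 + D 3 0) / 1260
        + D 1 1 / 105 - (D 2 2 + D 3 3) / 315 - (D 2 3 + D 3 2) / 630)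
      (fun k l => C (renumbering i k) (renumbering i l)) = 0 := by
    intro i
    have hσ := renumbering_bijective i
    have h' := (b.renumber hσ).setIntegral_divAt_mappedBubble_mul
      (fun k l => C (renumbering i k) (renumbering i l))
    have hz := h i
    rw [range_renumber] at h'
    -- Coordinates and coefficients are permuted together, so the polynomial does not change.
    have hsum : ∀ x, ∑ k, ∑ l, C (renumbering i k) (renumbering i l) *
        ((b.renumber hσ).coord k x * (b.renumber hσ).coord l x) =
        MvPolynomial.eval (fun k => x k) q := by
      intro x
      simp_rw [hC x, coord_renumber]
      rw [← hσ.sum_comp (fun k => ∑ l, C k l * (b.coord k x * b.coord l x))]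
      refine Finset.sum_congr rfl fun k _ => ?_
      rw [← hσ.sum_comp (fun l => C (renumbering i k) l * (b.coord (renumbering i k) x * b.coord l x))]
    simp_rw [hsum] at h'
    rw [coe_renumber] at h'
    rw [hz] at h'
    have hdet := (b.renumber hσ).det_jacobiMatrix_ne_zero
    rw [coe_renumber] at hdet
    exact (mul_eq_zero.1 h'.symm).resolve_left (abs_ne_zero.2 hdet)
  have e0 := key 0
  have e1 := key 1
  have e2 := key 2
  have e3 := key 3
  have e4 := key 4
  have e5 := key 5
  have e6 := key 6
  have e7 := key 7
  have e8 := key 8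
  clear key
  simp only [renumbering, Matrix.cons_val] at e0 e1 e2 e3 e4 e5 e6 e7 e8
  -- Only the symmetric part of `C` matters, with ten degrees of freedom. The nine equations make it
  -- `C 0 0` times that of (λ₀ + λ₁ + λ₂ + λ₃)², which is identically 1.
  have f1 : C 1 1 = C 0 0 := by linarith
  have f2 : C 2 2 = C 0 0 := by linarith
  have f3 : C 3 3 = C 0 0 := by linarith
  have g01 : C 1 0 = 2 * C 0 0 - C 0 1 := by linarith
  have g02 : C 2 0 = 2 * C 0 0 - C 0 2 := by linarith
  have g03 : C 3 0 = 2 * C 0 0 - C 0 3 := by linarith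
  have g12 : C 2 1 = 2 * C 0 0 - C 1 2 := by linarith
  have g13 : C 3 1 = 2 * C 0 0 - C 1 3 := by linarith
  have g23 : C 3 2 = 2 * C 0 0 - C 2 3 := by linarith
  refine ⟨C 0 0, fun x => ?_⟩
  have hsum := b.sum_coord_apply_eq_one x
  rw [Fin.sum_univ_four] at hsum
  rw [hC x]
  simp only [Fin.sum_univ_four, f1, f2, f3, g01, g02, g03, g12, g13, g23]
  linear_combination C 0 0 * (b.coord 0 x + b.coord 1 x + b.coord 2 x + b.coord 3 x + 1) * hsum

end AffineBasis

/-! ### Linear independence of the bubbles modulo cubic polynomials -/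

/-- Fourth differences of cubic polynomials vanish. -/
theorem fourthDifference_eval_eq_zero {q : MvPolynomial (Fin 3) ℝ}
    (hq : q ∈ MvPolynomial.restrictTotalDegree (Fin 3) ℝ 3) (x w : E3) :
    MvPolynomial.eval (fun k => x k) q - 4 * MvPolynomial.eval (fun k => (x + (1 : ℝ) • w) k) q
      + 6 * MvPolynomial.eval (fun k => (x + (2 : ℝ) • w) k) q
      - 4 * MvPolynomial.eval (fun k => (x + (3 : ℝ) • w) k) q
      + MvPolynomial.eval (fun k => (x + (4 : ℝ) • w) k) q = 0 := by
  rw [MvPolynomial.mem_restrictTotalDegree] at hq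
  -- The restriction to the line x + t w is a univariate polynomial in t of degree at most three.
  set P : Polynomial ℝ := MvPolynomial.aeval
    (fun k => Polynomial.C (x k) + Polynomial.X * Polynomial.C (w k)) q with hP
  have hdeg : P.natDegree < 4 := by
    have : P.natDegree ≤ 3 * 1 := MvPolynomial.aeval_natDegree_le q hq
      (fun k => Polynomial.C (x k) + Polynomial.X * Polynomial.C (w k)) (n := 1)
      (fun k => by compute_degree)
    omega
  have hev : ∀ t : ℝ, MvPolynomial.eval (fun k => (x + t • w) k) q = P.eval t := by
    intro t
    rw [hP, MvPolynomial.aeval_def, ← Polynomial.coe_evalRingHom, MvPolynomial.hom_eval₂]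
    change MvPolynomial.eval₂ (RingHom.id ℝ) _ q = _
    congr 1
    · ext r
      simp
    · funext k
      simp only [PiLp.add_apply, PiLp.smul_apply, smul_eq_mul,
        Polynomial.coe_evalRingHom, Polynomial.eval_add, Polynomial.eval_C, Polynomial.eval_mul,
        Polynomial.eval_X]
  have h0 : MvPolynomial.eval (fun k => x k) q = P.eval 0 := by
    rw [← hev 0, zero_smul, add_zero]
  rw [h0, hev, hev, hev, hev]
  simp only [Polynomial.eval_eq_sum_range' hdeg, Finset.sum_range_succ, Finset.sum_range_zero]
  ring

/-- The homogeneous part of degree four of `refBubble1`. -/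
noncomputable def leadingForm1 (x y z : ℝ) : ℝ :=
  263 / 12 * x ^ 4 + 38 * x ^ 3 * y + 265 / 3 * x ^ 3 * z + 29 * x ^ 2 * y ^ 2
    + 96 * x ^ 2 * y * z + 209 / 2 * x ^ 2 * z ^ 2 - 16 * x * y ^ 3 + 42 * x * y ^ 2 * z
    + 42 * x * y * z ^ 2 + 103 / 3 * x * z ^ 3 + 7 / 6 * y ^ 4 - y ^ 2 * z ^ 2 - 335 / 12 * z ^ 4

/-- The fourth difference kills all terms of degree at most three and turns the quartic part into 4!
= 24 times its value at the increment, whatever the base point. -/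
theorem fourthDifference_refBubble1 (x y z u v w : ℝ) :
    refBubble1 x y z - 4 * refBubble1 (x + 1 * u) (y + 1 * v) (z + 1 * w)
      + 6 * refBubble1 (x + 2 * u) (y + 2 * v) (z + 2 * w)
      - 4 * refBubble1 (x + 3 * u) (y + 3 * v) (z + 3 * w)
      + refBubble1 (x + 4 * u) (y + 4 * v) (z + 4 * w) = 24 * leadingForm1 u v w := by
  simp only [refBubble1, leadingForm1]
  ring

/-- The homogeneous part of degree four of `refBubble2`. -/
noncomputable def leadingForm2 (x y z : ℝ) : ℝ :=
  -(233 / 3) * x ^ 3 * y + 67 / 9 * x ^ 3 * z - 233 / 2 * x ^ 2 * y ^ 2 - 235 * x ^ 2 * y * z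
    + 163 / 6 * x ^ 2 * z ^ 2 - 203 / 3 * x * y ^ 3 - 225 * x * y ^ 2 * z - 209 * x * y * z ^ 2
    + 301 / 9 * x * z ^ 3 - 64 / 3 * y ^ 3 * z - 21 * y ^ 2 * z ^ 2 - 16 / 3 * y * z ^ 3

theorem fourthDifference_refBubble2 (x y z u v w : ℝ) :
    refBubble2 x y z - 4 * refBubble2 (x + 1 * u) (y + 1 * v) (z + 1 * w)
      + 6 * refBubble2 (x + 2 * u) (y + 2 * v) (z + 2 * w)
      - 4 * refBubble2 (x + 3 * u) (y + 3 * v) (z + 3 * w)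
      + refBubble2 (x + 4 * u) (y + 4 * v) (z + 4 * w) = 24 * leadingForm2 u v w := by
  simp only [refBubble2, leadingForm2]
  ring

/-- The homogeneous part of degree four of `refBubble3`. -/
noncomputable def leadingForm3 (x y z : ℝ) : ℝ :=
  -(10) * x ^ 3 * y - 10 * x ^ 3 * z + x ^ 2 * y ^ 2 + 119 * x ^ 2 * y * z - 15 * x ^ 2 * z ^ 2
    + 16 * x * y ^ 3 + 145 * x * y ^ 2 * z + 129 * x * y * z ^ 2 + 16 * y ^ 3 * z
    + 11 * y ^ 2 * z ^ 2 - 29 / 4 * z ^ 4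

theorem fourthDifference_refBubble3 (x y z u v w : ℝ) :
    refBubble3 x y z - 4 * refBubble3 (x + 1 * u) (y + 1 * v) (z + 1 * w)
      + 6 * refBubble3 (x + 2 * u) (y + 2 * v) (z + 2 * w)
      - 4 * refBubble3 (x + 3 * u) (y + 3 * v) (z + 3 * w)
      + refBubble3 (x + 4 * u) (y + 4 * v) (z + 4 * w) = 24 * leadingForm3 u v w := by
  simp only [refBubble3, leadingForm3]
  ring

/-- The leading forms of the reference bubble. -/
noncomputable def leadingForm (s : Fin 3 → ℝ) : Fin 3 → ℝ :=
  ![leadingForm1 (s 0) (s 1) (s 2), leadingForm2 (s 0) (s 1) (s 2), leadingForm3 (s 0) (s 1) (s 2)]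

theorem fourthDifference_refBubble (s e : Fin 3 → ℝ) (k : Fin 3) :
    refBubble s k - 4 * refBubble (fun j => s j + 1 * e j) k
      + 6 * refBubble (fun j => s j + 2 * e j) k - 4 * refBubble (fun j => s j + 3 * e j) k
      + refBubble (fun j => s j + 4 * e j) k = 24 * leadingForm e k := by
  fin_cases k
  · exact fourthDifference_refBubble1 _ _ _ _ _ _
  · exact fourthDifference_refBubble2 _ _ _ _ _ _
  · exact fourthDifference_refBubble3 _ _ _ _ _ _

-- The directions from vertex 0 along its three edges, with the components m = 0, 1, 2, already give
-- nine equations that force all nine unknowns to vanish. The component m = 3 is redundant, as the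
-- components sum to zero.
set_option maxHeartbeats 2000000 in
theorem eq_zero_of_leadingForm_combination_eq_zero {d : Fin 9 → ℝ}
    (hcoef : ∀ k l m, ∑ i, d i * ∑ n : Fin 3, (24 * leadingForm
      (fun j => 1 / 32 * ((if renumbering i j.succ = k then 1 else 0)
        - (if renumbering i j.succ = l then 1 else 0))) n) *
        ((if m = renumbering i n.succ then 1 else 0) - (if m = renumbering i 0 then 1 else 0))
        = 0) : ∀ i, d i = 0 := by
  have f1 : -(263 / 12) * d 0 + 211 / 6 * d 1 - 7 / 6 * d 2 + 263 / 12 * d 4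
      - 29 / 4 * d 5 + 361 / 12 * d 6 + 17 / 3 * d 7 - 145 / 6 * d 8 = 0 := by
    have h := hcoef 0 1 0
    simp [Fin.sum_univ_succ, renumbering, leadingForm, leadingForm1, leadingForm2,
      leadingForm3] at h
    -- The factor undoes the 24 of the fourth difference and, the leading forms being quartic, the
    -- scaling of the increment by 1/32.
    linear_combination 32 ^ 4 / 24 * h
  have f2 : 263 / 12 * d 0 - 29 / 4 * d 1 - 7 / 6 * d 3 - 263 / 12 * d 4
      + 211 / 6 * d 5 + 173 / 6 * d 6 - 49 / 4 * d 7 - 49 / 4 * d 8 = 0 := by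
    have h := hcoef 0 1 1
    simp [Fin.sum_univ_succ, renumbering, leadingForm, leadingForm1, leadingForm2,
      leadingForm3] at h
    linear_combination 32 ^ 4 / 24 * h
  have f3 : -(335 / 12) * d 1 + 7 / 6 * d 3
      - 647 / 12 * d 6 + 103 / 3 * d 7 - 247 / 18 * d 8 = 0 := by
    have h := hcoef 0 1 2
    simp [Fin.sum_univ_succ, renumbering, leadingForm, leadingForm1, leadingForm2,
      leadingForm3] at h
    linear_combination 32 ^ 4 / 24 * h
  have f4 : -(7 / 6) * d 0 - 263 / 12 * d 1 + 211 / 6 * d 2 + 173 / 6 * d 3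
      - 145 / 6 * d 4 - 49 / 4 * d 5 + 263 / 12 * d 6 + 361 / 12 * d 8 = 0 := by
    have h := hcoef 0 2 0
    simp [Fin.sum_univ_succ, renumbering, leadingForm, leadingForm1, leadingForm2,
      leadingForm3] at h
    linear_combination 32 ^ 4 / 24 * h
  have f5 : 7 / 6 * d 0 - 647 / 12 * d 3
      + 1805 / 36 * d 4 + 103 / 3 * d 5 - 5 * d 8 = 0 := by
    have h := hcoef 0 2 1
    simp [Fin.sum_univ_succ, renumbering, leadingForm, leadingForm1, leadingForm2,
      leadingForm3] at h
    linear_combination 32 ^ 4 / 24 * h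
  have f6 : 263 / 12 * d 1 - 29 / 4 * d 2 + 361 / 12 * d 3 - 49 / 4 * d 4
      + 17 / 3 * d 5 - 263 / 12 * d 6 - 7 / 6 * d 7 + 173 / 6 * d 8 = 0 := by
    have h := hcoef 0 2 2
    simp [Fin.sum_univ_succ, renumbering, leadingForm, leadingForm1, leadingForm2,
      leadingForm3] at h
    linear_combination 32 ^ 4 / 24 * h
  have f7 : 211 / 6 * d 0 - 7 / 6 * d 1 - 263 / 12 * d 2 + 17 / 3 * d 3
      + 361 / 12 * d 4 - 49 / 4 * d 5 - 145 / 6 * d 6 + 173 / 6 * d 7 + 263 / 12 * d 8 = 0 := by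
    have h := hcoef 0 3 0
    simp [Fin.sum_univ_succ, renumbering, leadingForm, leadingForm1, leadingForm2,
      leadingForm3] at h
    linear_combination 32 ^ 4 / 24 * h
  have f8 : -(335 / 12) * d 0 + 103 / 3 * d 3 - 647 / 12 * d 4
      + 1805 / 36 * d 5 - 247 / 18 * d 6 - 5 * d 7 = 0 := by
    have h := hcoef 0 3 1
    simp [Fin.sum_univ_succ, renumbering, leadingForm, leadingForm1, leadingForm2,
      leadingForm3] at h
    linear_combination 32 ^ 4 / 24 * h
  have f9 : 7 / 6 * d 1 - 111 / 4 * d 3 - 5 * d 4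
      - 247 / 18 * d 5 + 1805 / 36 * d 6 - 647 / 12 * d 7 = 0 := by
    have h := hcoef 0 3 2
    simp [Fin.sum_univ_succ, renumbering, leadingForm, leadingForm1, leadingForm2,
      leadingForm3] at h
    linear_combination 32 ^ 4 / 24 * h
  clear hcoef
  have d0 : d 0 = 0 := by linarith
  have d1 : d 1 = 0 := by linarith
  have d2 : d 2 = 0 := by linarith
  have d3 : d 3 = 0 := by linarith
  have d4 : d 4 = 0 := by linarith
  have d5 : d 5 = 0 := by linarith
  have d6 : d 6 = 0 := by linarith
  have d7 : d 7 = 0 := by linarith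
  have d8 : d 8 = 0 := by linarith
  intro i
  fin_cases i <;> assumption

namespace AffineBasis

variable (b : AffineBasis (Fin 4) ℝ E3)

theorem fourthDifference_mappedBubble (x w : E3) :
    mappedBubble b x - (4 : ℝ) • mappedBubble b (x + (1 : ℝ) • w)
      + (6 : ℝ) • mappedBubble b (x + (2 : ℝ) • w) - (4 : ℝ) • mappedBubble b (x + (3 : ℝ) • w)
      + mappedBubble b (x + (4 : ℝ) • w) =
      ∑ k : Fin 3, (24 * leadingForm (fun j => (b.coord j.succ).linear w) k) •
        (b k.succ - b 0) := by
  simp only [mappedBubble_eq, Finset.smul_sum, ← Finset.sum_sub_distrib, ← Finset.sum_add_distrib,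
    coord_add_vec, map_smul, smul_eq_mul, smul_smul, ← sub_smul, ← add_smul,
    fourthDifference_refBubble]

/-- A combination of the nine bubbles of a tetrahedron that is a cubic polynomial is trivial. -/
theorem bubble_coeff_eq_zero {d : Fin 9 → ℝ} {q : Fin 3 → MvPolynomial (Fin 3) ℝ}
    (hq : ∀ m, q m ∈ MvPolynomial.restrictTotalDegree (Fin 3) ℝ 3)
    (h : ∀ x ∈ interior (convexHull ℝ (Set.range b)), ∀ m,
      (∑ i, d i • mappedBubble (fun k => b (renumbering i k)) x) m =
        MvPolynomial.eval (fun k => x k) (q m)) :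
    ∀ i, d i = 0 := by
  set x₀ : E3 := b.param (fun _ => 1 / 4) with hx₀
  have hc : ∀ m, b.coord m x₀ = 1 / 4 := by
    intro m
    cases m using Fin.cases with
    | zero => rw [hx₀, coord_zero_param]; norm_num
    | succ m => rw [hx₀, coord_param]
  -- From the barycenter, where all coordinates are 1/4, four steps of 1/32 lower a coordinate by at
  -- most 1/8, so all five sample points stay inside.
  have hmem : ∀ k l, ∀ t : ℝ, 0 ≤ t → t ≤ 4 →
      x₀ + t • (1 / 32 : ℝ) • (b k - b l) ∈ interior (convexHull ℝ (Set.range b)) := by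
    intro k l t h0 h4
    rw [b.interior_convexHull]
    intro m
    rw [smul_smul, coord_add_smul_sub, hc]
    split_ifs <;> linarith
  have hlead : ∀ k l, ∑ i, d i • ∑ n : Fin 3, (24 * leadingForm
      (fun j => (b.coord (renumbering i j.succ)).linear ((1 / 32 : ℝ) • (b k - b l))) n) •
        (b (renumbering i n.succ) - b (renumbering i 0)) = 0 := by
    intro k l
    set w := (1 / 32 : ℝ) • (b k - b l) with hw
    have h4 : ∀ i, _ := fun i =>
      (b.renumber (renumbering_bijective i)).fourthDifference_mappedBubble x₀ w
    simp only [coord_renumber, coe_renumber] at h4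
    simp_rw [← h4, smul_add, smul_sub, smul_add, smul_sub, Finset.sum_add_distrib,
      Finset.sum_sub_distrib, Finset.sum_add_distrib, Finset.sum_sub_distrib, smul_comm (d _),
      ← Finset.smul_sum]
    ext m
    have e0 := h x₀ (by simpa using hmem 0 0 0 (by norm_num) (by norm_num)) m
    have e1 := h _ (hmem k l 1 (by norm_num) (by norm_num)) m
    have e2 := h _ (hmem k l 2 (by norm_num) (by norm_num)) m
    have e3 := h _ (hmem k l 3 (by norm_num) (by norm_num)) m
    have e4 := h _ (hmem k l 4 (by norm_num) (by norm_num)) m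
    rw [← hw] at e1 e2 e3 e4
    have := fourthDifference_eval_eq_zero (hq m) x₀ w
    rw [← e0, ← e1, ← e2, ← e3, ← e4] at this
    simpa only [PiLp.add_apply, PiLp.sub_apply, PiLp.smul_apply, smul_eq_mul, PiLp.zero_apply]
      using this
  -- Taking barycentric components of the vector identity removes the geometry and leaves a
  -- numerical system common to all tetrahedra.
  have hcoef : ∀ k l m, ∑ i, d i * ∑ n : Fin 3, (24 * leadingForm
      (fun j => 1 / 32 * ((if renumbering i j.succ = k then 1 else 0)
        - (if renumbering i j.succ = l then 1 else 0))) n) *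
        ((if m = renumbering i n.succ then 1 else 0) - (if m = renumbering i 0 then 1 else 0))
        = 0 := by
    intro k l m
    have := congrArg (b.coord m).linear (hlead k l)
    simpa only [map_sum, map_smul, coord_linear_sub, smul_eq_mul, map_zero] using this
  exact eq_zero_of_leadingForm_combination_eq_zero hcoef

end AffineBasis

/-! ### Saddle point problems and closed covers -/

/-- Unique solvability of finite-dimensional saddle point problems. -/
theorem existsUnique_saddlePoint {V P : Type*} [AddCommGroup V] [Module ℝ V] [AddCommGroup P]
    [Module ℝ P] [FiniteDimensional ℝ V] [FiniteDimensional ℝ P]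
    (A : V →ₗ[ℝ] V →ₗ[ℝ] ℝ) (B : V →ₗ[ℝ] P →ₗ[ℝ] ℝ) (F : V →ₗ[ℝ] ℝ)
    (hA : ∀ u, A u u = 0 → u = 0) (hB : ∀ p, (∀ v, B v p = 0) → p = 0) :
    ∃! up : V × P, (∀ v, A up.1 v - B v up.2 = F v) ∧ ∀ q, B up.1 q = 0 := by
  -- Both equations are tested at once. With u itself as test function, the pressure term drops by
  -- the second equation, so definiteness gives u = 0.
  set Φ : V × P →ₗ[ℝ] Module.Dual ℝ (V × P) :=
    LinearMap.mk₂ ℝ (fun x y : V × P => A x.1 y.1 - B y.1 x.2 + B x.1 y.2)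
      (fun x x' y => by simp; ring) (fun c x y => by simp; ring)
      (fun x y y' => by simp; ring) (fun c x y => by simp; ring) with hΦ
  have hΦa : ∀ x y, Φ x y = A x.1 y.1 - B y.1 x.2 + B x.1 y.2 := fun x y => rfl
  have hinj : Function.Injective Φ := by
    rw [injective_iff_map_eq_zero]
    rintro ⟨u, p⟩ h
    have h' : ∀ y : V × P, A u y.1 - B y.1 p + B u y.2 = 0 := fun y => by
      rw [← hΦa (u, p) y, h]; rfl
    have h2 : ∀ q, B u q = 0 := fun q => by simpa using h' (0, q)
    have h1 : ∀ v, A u v - B v p = 0 := fun v => by simpa using h' (v, 0)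
    have hu : u = 0 := hA u (by simpa [h2 p] using h1 u)
    subst hu
    have hp : p = 0 := hB p (fun v => by simpa using h1 v)
    rw [hp]; rfl
  have hsurj : Function.Surjective Φ :=
    (LinearMap.injective_iff_surjective_of_finrank_eq_finrank
      (Subspace.dual_finrank_eq (K := ℝ) (V := V × P)).symm).1 hinj
  have hiff : ∀ up : V × P, ((∀ v, A up.1 v - B v up.2 = F v) ∧ ∀ q, B up.1 q = 0) ↔
      Φ up = F ∘ₗ LinearMap.fst ℝ V P := by
    intro up
    constructor
    · rintro ⟨h1, h2⟩
      ext y <;> simp [hΦa, h1, h2]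
    · intro h
      have h' : ∀ y : V × P, A up.1 y.1 - B y.1 up.2 + B up.1 y.2 = F y.1 := fun y => by
        rw [← hΦa up y, h]; rfl
      exact ⟨fun v => by simpa using h' (v, 0), fun q => by simpa using h' (0, q)⟩
  obtain ⟨x, hx⟩ := hsurj (F ∘ₗ LinearMap.fst ℝ V P)
  exact ⟨x, (hiff x).2 hx, fun y hy => hinj (((hiff y).1 hy).trans hx.symm)⟩

/-- Values attached to the members of a finite closed cover that agree on overlaps agree on any two
members that meet the same preconnected set. -/
theorem IsPreconnected.eq_of_closed_cover {X ι α : Type*} [TopologicalSpace X] [Finite ι]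
    {S : Set X} (hS : IsPreconnected S) {A : ι → Set X} (hA : ∀ i, IsClosed (A i))
    (hcov : S ⊆ ⋃ i, A i) {c : ι → α}
    (hc : ∀ x ∈ S, ∀ i j, x ∈ A i → x ∈ A j → c i = c j) {i j : ι}
    (hi : (S ∩ A i).Nonempty) (hj : (S ∩ A j).Nonempty) : c i = c j := by
  by_contra hne
  -- The members with value `c i` and the remaining ones have closed unions. If both met S, they
  -- would meet each other in S, where values agree.
  have h := isPreconnected_closed_iff.1 hS (⋃ k ∈ {k | c k = c i}, A k) (⋃ k ∈ {k | c k ≠ c i}, A k)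
    ((Set.toFinite _).isClosed_biUnion fun k _ => hA k)
    ((Set.toFinite _).isClosed_biUnion fun k _ => hA k) ?_ ?_ ?_
  · obtain ⟨x, hxS, hx1, hx2⟩ := h
    simp only [Set.mem_iUnion, Set.mem_ofPred_eq, exists_prop] at hx1 hx2
    obtain ⟨k, hk, hxk⟩ := hx1
    obtain ⟨l, hl, hxl⟩ := hx2
    exact hl ((hc x hxS l k hxl hxk).trans hk)
  · intro x hx
    obtain ⟨k, hk⟩ := Set.mem_iUnion.1 (hcov hx)
    by_cases h : c k = c i
    · exact Or.inl (Set.mem_biUnion (s := {k | c k = c i}) h hk)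
    · exact Or.inr (Set.mem_biUnion (s := {k | c k ≠ c i}) h hk)
  · obtain ⟨x, hx, hxi⟩ := hi
    exact ⟨x, hx, Set.mem_biUnion (s := {k | c k = c i}) rfl hxi⟩
  · obtain ⟨x, hx, hxj⟩ := hj
    exact ⟨x, hx, Set.mem_biUnion (s := {k | c k ≠ c i}) (Ne.symm hne) hxj⟩

theorem AffineBasis.coord_eq_zero_of_mem_convexHull (b : AffineBasis (Fin 4) ℝ E3) {i : Fin 4}
    {S : Set E3} (hS : ∀ y ∈ S, b.coord i y = 0) {x : E3} (hx : x ∈ convexHull ℝ S) :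
    b.coord i x = 0 :=
  convexHull_min (t := b.coord i ⁻¹' {0}) hS ((convex_singleton 0).affine_preimage _) hx

theorem MvPolynomial.contDiff_eval_coord {n : WithTop ℕ∞} (q : MvPolynomial (Fin 3) ℝ) :
    ContDiff ℝ n (fun x : E3 => MvPolynomial.eval (fun k => x k) q) := by
  simp_rw [MvPolynomial.eval_eq']
  fun_prop

/-! ### Grid geometry and the velocity space on one tetrahedron -/

namespace TetMesh

variable {Ω : Set E3} (M : TetMesh Ω)

/-- The vertices of a tetrahedron as an affine basis. -/
noncomputable def basis (T : Fin M.nt) : AffineBasis (Fin 4) ℝ E3 := (M.affineIndependent T).tetBasis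

theorem coe_basis (T : Fin M.nt) : ⇑(M.basis T) = M.vertex T := rfl

theorem tet_eq (T : Fin M.nt) : M.tet T = convexHull ℝ (Set.range (M.basis T)) := rfl

theorem mem_interior_tet_iff {T : Fin M.nt} {x : E3} :
    x ∈ interior (M.tet T) ↔ ∀ i, 0 < (M.basis T).coord i x := by
  rw [tet_eq, (M.basis T).interior_convexHull]
  rfl

theorem isCompact_tet (T : Fin M.nt) : IsCompact (M.tet T) :=
  (Set.finite_range _).isCompact_convexHull ℝ

theorem convex_tet (T : Fin M.nt) : Convex ℝ (M.tet T) := convex_convexHull ℝ _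

theorem nonempty_interior_tet (T : Fin M.nt) : (interior (M.tet T)).Nonempty :=
  ⟨_, (M.basis T).centroid_mem_interior_convexHull⟩

theorem closure_interior_tet (T : Fin M.nt) : closure (interior (M.tet T)) = M.tet T := by
  rw [(M.convex_tet T).closure_interior_eq_closure_of_nonempty_interior
    (M.nonempty_interior_tet T), (M.isCompact_tet T).isClosed.closure_eq]

theorem iUnion_tet : ⋃ T, M.tet T = closure Ω := M.cover

theorem tet_subset (T : Fin M.nt) : M.tet T ⊆ closure Ω := by
  rw [← M.iUnion_tet]
  exact Set.subset_iUnion _ T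

theorem isCompact_closure {Ω : Set E3} (M : TetMesh Ω) : IsCompact (closure Ω) := by
  rw [← M.iUnion_tet]
  exact isCompact_iUnion M.isCompact_tet

theorem interior_tet_subset (hreg : interior (closure Ω) = Ω) (T : Fin M.nt) :
    interior (M.tet T) ⊆ Ω :=
  (interior_mono (M.tet_subset T)).trans hreg.subset

theorem exists_tet_of_mem {x : E3} (hx : x ∈ Ω) : ∃ T, x ∈ M.tet T := by
  rw [← Set.mem_iUnion, M.iUnion_tet]
  exact subset_closure hx

theorem exists_vertex_notMem {T T' : Fin M.nt} (h : T ≠ T') :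
    ∃ i, M.vertex T i ∉ Set.range (M.vertex T') := by
  by_contra! hc
  refine M.range_ne T T' h (Set.eq_of_subset_of_ncard_le (Set.range_subset_iff.2 hc) ?_)
  have hn : ∀ S : Fin M.nt, (Set.range (M.vertex S)).ncard = 4 := fun S => by
    rw [← Set.image_univ, Set.ncard_image_of_injective _ (M.affineIndependent S).injective,
      Set.ncard_univ]
    simp
  rw [hn, hn]

/-- A common point lies in the hull of the common vertices, where the coordinate of an unshared
vertex vanishes. The numbering `b` is left free so that faces can later be placed opposite to vertex
3. -/
theorem coord_eq_zero_of_mem_inter {T T' : Fin M.nt} (h : T ≠ T') {b : AffineBasis (Fin 4) ℝ E3}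
    (hb : Set.range b = Set.range (M.vertex T)) {i : Fin 4}
    (hi : b i ∉ Set.range (M.vertex T')) {x : E3} (hx : x ∈ M.tet T)
    (hx' : x ∈ M.tet T') : b.coord i x = 0 := by
  have hmem : x ∈ convexHull ℝ (Set.range b ∩ Set.range (M.vertex T')) := by
    rw [hb, ← M.inter_eq T T' h]
    exact ⟨hx, hx'⟩
  refine b.coord_eq_zero_of_mem_convexHull ?_ hmem
  rintro _ ⟨⟨j, rfl⟩, hj⟩
  refine b.coord_apply_ne ?_
  rintro rfl
  exact hi hj

theorem notMem_tet_of_mem_interior {T T' : Fin M.nt} (h : T ≠ T') {x : E3}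
    (hx : x ∈ interior (M.tet T)) : x ∉ M.tet T' := by
  intro hx'
  obtain ⟨i, hi⟩ := M.exists_vertex_notMem h
  have h0 := M.coord_eq_zero_of_mem_inter h (b := M.basis T) rfl hi (interior_subset hx) hx'
  exact (M.mem_interior_tet_iff.1 hx i).ne' h0

theorem mem_velocitySpace_iff {v : E3 → E3} : v ∈ M.velocitySpace ↔
    ∃ vc ∈ M.conformingP3, ∃ d : Fin M.nt → Fin 9 → ℝ,
      v = vc + ∑ T, ∑ i, d T i • M.bubble T i := by
  rw [velocitySpace, Submodule.mem_sup]
  constructor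
  · rintro ⟨vc, hvc, w, hw, rfl⟩
    obtain ⟨d, rfl⟩ := (Submodule.mem_span_range_iff_exists_fun ℝ).1 hw
    exact ⟨vc, hvc, fun T i => d (T, i), by rw [Fintype.sum_prod_type]⟩
  · rintro ⟨vc, hvc, d, rfl⟩
    refine ⟨vc, hvc, _, (Submodule.mem_span_range_iff_exists_fun ℝ).2 ⟨fun Ti => d Ti.1 Ti.2, rfl⟩,
      ?_⟩
    rw [Fintype.sum_prod_type]

theorem bubble_mem_velocitySpace (T : Fin M.nt) (i : Fin 9) : M.bubble T i ∈ M.velocitySpace :=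
  Submodule.mem_sup_right (Submodule.subset_span ⟨(T, i), rfl⟩)

theorem bubble_apply_of_ne {S T : Fin M.nt} (h : S ≠ T) (i : Fin 9) {x : E3}
    (hx : x ∈ interior (M.tet T)) : M.bubble S i x = 0 :=
  Set.indicator_of_notMem (fun hx' => M.notMem_tet_of_mem_interior h hx' (interior_subset hx)) _

theorem bubble_apply_self {T : Fin M.nt} (i : Fin 9) {x : E3} (hx : x ∈ interior (M.tet T)) :
    M.bubble T i x = mappedBubble (fun k => M.basis T (renumbering i k)) x :=
  Set.indicator_of_mem hx _

theorem sum_bubble_apply (d : Fin M.nt → Fin 9 → ℝ) {T : Fin M.nt} {x : E3}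
    (hx : x ∈ interior (M.tet T)) : (∑ S, ∑ i, d S i • M.bubble S i) x =
      ∑ i, d T i • mappedBubble (fun k => M.basis T (renumbering i k)) x := by
  simp only [Finset.sum_apply, Pi.smul_apply]
  rw [Finset.sum_eq_single T]
  · exact Finset.sum_congr rfl fun i _ => by rw [M.bubble_apply_self i hx]
  · intro S _ hS
    exact Finset.sum_eq_zero fun i _ => by rw [M.bubble_apply_of_ne hS i hx, smul_zero]
  · simp

theorem contDiff_mappedBubble_renumbering (T : Fin M.nt) (i : Fin 9) {n : WithTop ℕ∞} :
    ContDiff ℝ n (mappedBubble fun k => M.basis T (renumbering i k)) :=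
  ((M.basis T).renumber (renumbering_bijective i)).contDiff_mappedBubble

/-- On every open tetrahedron, the functions of the velocity space are smooth. -/
theorem exists_contDiff_eqOn {v : E3 → E3} (hv : v ∈ M.velocitySpace) (T : Fin M.nt) :
    ∃ g : E3 → E3, ContDiff ℝ 1 g ∧ Set.EqOn v g (interior (M.tet T)) := by
  obtain ⟨vc, ⟨-, -, hp⟩, d, rfl⟩ := M.mem_velocitySpace_iff.1 hv
  choose q hq hqe using hp T
  refine ⟨fun x => WithLp.toLp 2 (fun m => MvPolynomial.eval (fun k => x k) (q m)) +
    ∑ i, d T i • mappedBubble (fun k => M.basis T (renumbering i k)) x, ?_, ?_⟩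
  · refine ContDiff.add ?_ (ContDiff.sum fun i _ =>
      (M.contDiff_mappedBubble_renumbering T i).const_smul (d T i))
    rw [contDiff_euclidean]
    exact fun m => MvPolynomial.contDiff_eval_coord (q m)
  · intro x hx
    simp only [Pi.add_apply, M.sum_bubble_apply d hx]
    congr 1
    ext m
    exact hqe m x (interior_subset hx)

end TetMesh

/-! ### The bilinear forms and the load functional -/

theorem ContDiff.continuous_fderiv_apply_coord {g : E3 → E3} (hg : ContDiff ℝ 1 g) (w : E3)
    (i : Fin 3) : Continuous fun x => (fderiv ℝ g x w) i := by
  have h := (hg.continuous_fderiv one_ne_zero).clm_apply (continuous_const (y := w))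
  exact (EuclideanSpace.proj (𝕜 := ℝ) i).continuous.comp h

theorem ContDiff.continuous_gradInnerAt {g h : E3 → E3} (hg : ContDiff ℝ 1 g)
    (hh : ContDiff ℝ 1 h) : Continuous (gradInnerAt g h) := by
  unfold gradInnerAt
  exact continuous_finsetSum _ fun i _ => continuous_finsetSum _ fun j _ =>
    (hg.continuous_fderiv_apply_coord _ _).mul (hh.continuous_fderiv_apply_coord _ _)

theorem ContDiff.continuous_divAt {g : E3 → E3} (hg : ContDiff ℝ 1 g) : Continuous (divAt g) := by
  unfold divAt
  exact continuous_finsetSum _ fun j _ => hg.continuous_fderiv_apply_coord _ _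

theorem fderiv_eq_zero_of_gradInnerAt_self {g : E3 → E3} {x : E3} (h : gradInnerAt g g x = 0) :
    fderiv ℝ g x = 0 := by
  have h1 : ∀ i j : Fin 3, (fderiv ℝ g x (EuclideanSpace.single j 1)) i = 0 := by
    intro i j
    have h2 := (Finset.sum_eq_zero_iff_of_nonneg (fun i _ =>
      Finset.sum_nonneg fun j _ => mul_self_nonneg _)).1 h i (Finset.mem_univ i)
    have h3 := (Finset.sum_eq_zero_iff_of_nonneg (fun j _ => mul_self_nonneg _)).1 h2 j
      (Finset.mem_univ j)
    exact mul_self_eq_zero.1 h3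
  ext w i
  have hw : w = ∑ j, w j • EuclideanSpace.single j (1 : ℝ) := by
    ext m
    simp [Pi.single_apply]
  rw [hw, map_sum]
  simp [h1]

namespace TetMesh

variable {Ω : Set E3} (M : TetMesh Ω)

theorem differentiableAt_of_mem {v : E3 → E3} (hv : v ∈ M.velocitySpace) {T : Fin M.nt} {x : E3}
    (hx : x ∈ interior (M.tet T)) : DifferentiableAt ℝ v x := by
  obtain ⟨g, hg, hvg⟩ := M.exists_contDiff_eqOn hv T
  exact ((hg.differentiable one_ne_zero).differentiableAt).congr_of_eventuallyEq
    (hvg.eventuallyEq_of_mem (isOpen_interior.mem_nhds hx))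

theorem fderiv_eq_of_eqOn {v g : E3 → E3} {T : Fin M.nt}
    (hvg : Set.EqOn v g (interior (M.tet T))) {x : E3} (hx : x ∈ interior (M.tet T)) :
    fderiv ℝ v x = fderiv ℝ g x :=
  (hvg.eventuallyEq_of_mem (isOpen_interior.mem_nhds hx)).fderiv_eq

theorem integrableOn_gradInnerAt {u v : E3 → E3} (hu : u ∈ M.velocitySpace)
    (hv : v ∈ M.velocitySpace) (T : Fin M.nt) :
    IntegrableOn (gradInnerAt u v) (interior (M.tet T)) := by
  obtain ⟨g, hg, hug⟩ := M.exists_contDiff_eqOn hu T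
  obtain ⟨h, hh, hvh⟩ := M.exists_contDiff_eqOn hv T
  have hi : IntegrableOn (gradInnerAt g h) (interior (M.tet T)) :=
    ((hg.continuous_gradInnerAt hh).continuousOn.integrableOn_compact
      (M.isCompact_tet T)).mono_set interior_subset
  refine hi.congr_fun (fun x hx => ?_) isOpen_interior.measurableSet
  simp only [gradInnerAt, M.fderiv_eq_of_eqOn hug hx, M.fderiv_eq_of_eqOn hvh hx]

theorem integrableOn_divAt_mul {v : E3 → E3} (hv : v ∈ M.velocitySpace) (T : Fin M.nt)
    {p : E3 → ℝ} (hp : IntegrableOn p (interior (M.tet T))) :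
    IntegrableOn (fun x => divAt v x * p x) (interior (M.tet T)) := by
  obtain ⟨g, hg, hvg⟩ := M.exists_contDiff_eqOn hv T
  have hi : IntegrableOn (fun x => divAt g x * p x) (interior (M.tet T)) :=
    hp.continuousOn_mul_of_subset hg.continuous_divAt.continuousOn (M.isCompact_tet T)
      isOpen_interior.measurableSet interior_subset
  refine hi.congr_fun (fun x hx => ?_) isOpen_interior.measurableSet
  simp only [divAt, M.fderiv_eq_of_eqOn hvg hx]

theorem gradForm_comm (u v : E3 → E3) : M.gradForm u v = M.gradForm v u := by
  simp only [gradForm, gradInnerAt, mul_comm]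

theorem gradForm_add_left {u u' v : E3 → E3} (hu : u ∈ M.velocitySpace)
    (hu' : u' ∈ M.velocitySpace) (hv : v ∈ M.velocitySpace) :
    M.gradForm (u + u') v = M.gradForm u v + M.gradForm u' v := by
  simp only [gradForm, ← Finset.sum_add_distrib]
  refine Finset.sum_congr rfl fun T _ => ?_
  rw [← integral_add (M.integrableOn_gradInnerAt hu hv T) (M.integrableOn_gradInnerAt hu' hv T)]
  refine setIntegral_congr_fun isOpen_interior.measurableSet fun x hx => ?_
  simp only [gradInnerAt]
  rw [fderiv_add (M.differentiableAt_of_mem hu hx) (M.differentiableAt_of_mem hu' hx)]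
  simp only [add_apply, PiLp.add_apply, add_mul, Finset.sum_add_distrib]

theorem gradForm_smul_left {u v : E3 → E3} (c : ℝ) (hu : u ∈ M.velocitySpace) :
    M.gradForm (c • u) v = c * M.gradForm u v := by
  simp only [gradForm, Finset.mul_sum]
  refine Finset.sum_congr rfl fun T _ => ?_
  rw [← integral_const_mul]
  refine setIntegral_congr_fun isOpen_interior.measurableSet fun x hx => ?_
  simp only [gradInnerAt]
  rw [fderiv_const_smul (M.differentiableAt_of_mem hu hx)]
  simp only [smul_apply, PiLp.smul_apply, smul_eq_mul, Finset.mul_sum,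
    mul_assoc]

theorem divForm_add_left {v v' : E3 → E3} (hv : v ∈ M.velocitySpace) (hv' : v' ∈ M.velocitySpace)
    {p : E3 → ℝ} (hp : ∀ T, IntegrableOn p (interior (M.tet T))) :
    M.divForm (v + v') p = M.divForm v p + M.divForm v' p := by
  simp only [divForm, ← Finset.sum_add_distrib]
  refine Finset.sum_congr rfl fun T _ => ?_
  rw [← integral_add (M.integrableOn_divAt_mul hv T (hp T))
    (M.integrableOn_divAt_mul hv' T (hp T))]
  refine setIntegral_congr_fun isOpen_interior.measurableSet fun x hx => ?_
  simp only [divAt]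
  rw [fderiv_add (M.differentiableAt_of_mem hv hx) (M.differentiableAt_of_mem hv' hx)]
  simp only [add_apply, PiLp.add_apply, add_mul, Finset.sum_add_distrib]

theorem divForm_smul_left {v : E3 → E3} (c : ℝ) (hv : v ∈ M.velocitySpace) (p : E3 → ℝ) :
    M.divForm (c • v) p = c * M.divForm v p := by
  simp only [divForm, Finset.mul_sum]
  refine Finset.sum_congr rfl fun T _ => ?_
  rw [← integral_const_mul]
  refine setIntegral_congr_fun isOpen_interior.measurableSet fun x hx => ?_
  simp only [divAt]
  rw [fderiv_const_smul (M.differentiableAt_of_mem hv hx)]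
  simp only [smul_apply, PiLp.smul_apply, smul_eq_mul, Finset.mul_sum,
    Finset.sum_mul, mul_assoc]

theorem divForm_congr_ae (v : E3 → E3) {p p' : E3 → ℝ}
    (h : ∀ T, p =ᵐ[volume.restrict (interior (M.tet T))] p') : M.divForm v p = M.divForm v p' := by
  refine Finset.sum_congr rfl fun T _ => integral_congr_ae ?_
  filter_upwards [h T] with x hx
  rw [hx]

theorem divForm_add_right {v : E3 → E3} (hv : v ∈ M.velocitySpace) {p p' : E3 → ℝ}
    (hp : ∀ T, IntegrableOn p (interior (M.tet T)))
    (hp' : ∀ T, IntegrableOn p' (interior (M.tet T))) :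
    M.divForm v (p + p') = M.divForm v p + M.divForm v p' := by
  simp only [divForm, ← Finset.sum_add_distrib]
  refine Finset.sum_congr rfl fun T _ => ?_
  rw [← integral_add (M.integrableOn_divAt_mul hv T (hp T))
    (M.integrableOn_divAt_mul hv T (hp' T))]
  simp only [Pi.add_apply, mul_add]

theorem divForm_smul_right (v : E3 → E3) (c : ℝ) (p : E3 → ℝ) :
    M.divForm v (c • p) = c * M.divForm v p := by
  simp only [divForm, Finset.mul_sum]
  refine Finset.sum_congr rfl fun T _ => ?_
  rw [← integral_const_mul]
  simp only [Pi.smul_apply, smul_eq_mul, mul_left_comm]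

theorem ae_interior_of_ae (hreg : interior (closure Ω) = Ω) (T : Fin M.nt) {P : E3 → Prop}
    (h : ∀ᵐ x ∂(volume.restrict Ω), P x) : ∀ᵐ x ∂(volume.restrict (interior (M.tet T))), P x :=
  ae_restrict_of_ae_restrict_of_subset (M.interior_tet_subset hreg T) h

theorem integrableOn_interior_of_mem (hreg : interior (closure Ω) = Ω)
    {p : Lp ℝ 2 (volume.restrict Ω)} (hp : p ∈ M.pressureSpace) (T : Fin M.nt) :
    IntegrableOn p (interior (M.tet T)) :=
  IntegrableOn.mono_set (s := interior (M.tet T)) (t := Ω) hp.1.1 (M.interior_tet_subset hreg T)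

theorem isFiniteMeasure_restrict {Ω : Set E3} (M : TetMesh Ω) :
    IsFiniteMeasure (volume.restrict Ω) :=
  ⟨by simpa using (measure_mono subset_closure).trans_lt M.isCompact_closure.measure_lt_top⟩

theorem memLp_of_continuousOn {Ω : Set E3} (M : TetMesh Ω) {v : E3 → E3}
    (hv : ContinuousOn v (closure Ω)) : MemLp v 2 (volume.restrict Ω) := by
  have hfin : IsFiniteMeasure (volume.restrict (closure Ω)) :=
    ⟨by simpa using M.isCompact_closure.measure_lt_top⟩
  obtain ⟨C, hC⟩ := M.isCompact_closure.exists_bound_of_continuousOn hv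
  exact (MemLp.of_bound (hv.aestronglyMeasurable isClosed_closure.measurableSet) C
    (ae_restrict_of_forall_mem isClosed_closure.measurableSet hC)).mono_measure
    (Measure.restrict_mono subset_closure le_rfl)

theorem memLp_of_mem {v : E3 → E3} (hv : v ∈ M.velocitySpace) :
    MemLp v 2 (volume.restrict Ω) := by
  obtain ⟨vc, hvc, d, rfl⟩ := M.mem_velocitySpace_iff.1 hv
  refine (M.memLp_of_continuousOn hvc.1).add (memLp_finsetSum' _ fun T _ =>
    memLp_finsetSum' _ fun i _ => MemLp.const_smul ?_ _)
  exact (M.memLp_of_continuousOn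
    (M.contDiff_mappedBubble_renumbering T i (n := 0)).continuous.continuousOn).indicator
    isOpen_interior.measurableSet

theorem integrable_inner_of_mem (f : Lp E3 2 (volume.restrict Ω)) {v : E3 → E3}
    (hv : v ∈ M.velocitySpace) : Integrable (fun x => inner ℝ (f x) (v x)) (volume.restrict Ω) := by
  refine (L2.integrable_inner (𝕜 := ℝ) f (M.memLp_of_mem hv).toLp).congr ?_
  filter_upwards [(M.memLp_of_mem hv).coeFn_toLp] with x hx
  rw [hx]

/-- The form `(∇u, ∇v)` on the velocity space. -/
noncomputable def gradBilin : M.velocitySpace →ₗ[ℝ] M.velocitySpace →ₗ[ℝ] ℝ :=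
  LinearMap.mk₂ ℝ (fun u v => M.gradForm u v)
    (fun u u' v => M.gradForm_add_left u.2 u'.2 v.2)
    (fun c u _ => M.gradForm_smul_left c u.2)
    (fun u v v' => by
      rw [M.gradForm_comm, M.gradForm_comm u v, M.gradForm_comm u v']
      exact M.gradForm_add_left v.2 v'.2 u.2)
    (fun c u v => by
      rw [M.gradForm_comm, M.gradForm_comm u v]
      exact M.gradForm_smul_left c v.2)

/-- The form `(div v, p)` on the product of the velocity and the pressure space. -/
noncomputable def divBilin (hreg : interior (closure Ω) = Ω) :
    M.velocitySpace →ₗ[ℝ] M.pressureSpace →ₗ[ℝ] ℝ :=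
  LinearMap.mk₂ ℝ (fun v p => M.divForm v (p : Lp ℝ 2 (volume.restrict Ω)))
    (fun v v' p => M.divForm_add_left v.2 v'.2 (M.integrableOn_interior_of_mem hreg p.2))
    (fun c v p => M.divForm_smul_left c v.2 _)
    (fun v p p' => by
      rw [← M.divForm_add_right v.2 (M.integrableOn_interior_of_mem hreg p.2)
        (M.integrableOn_interior_of_mem hreg p'.2)]
      exact M.divForm_congr_ae _ fun T => M.ae_interior_of_ae hreg T (Lp.coeFn_add _ _))
    (fun c v p => by
      rw [smul_eq_mul, ← M.divForm_smul_right]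
      exact M.divForm_congr_ae _ fun T => M.ae_interior_of_ae hreg T (Lp.coeFn_smul _ _))

/-- The functional `v ↦ (f, v)` on the velocity space. -/
noncomputable def loadFunctional (f : Lp E3 2 (volume.restrict Ω)) :
    M.velocitySpace →ₗ[ℝ] ℝ where
  toFun v := ∫ x in Ω, inner ℝ (f x) ((v : E3 → E3) x)
  map_add' v v' := by
    rw [← integral_add (M.integrable_inner_of_mem f v.2) (M.integrable_inner_of_mem f v'.2)]
    simp only [Submodule.coe_add, Pi.add_apply, inner_add_right]
  map_smul' c v := by
    rw [RingHom.id_apply, smul_eq_mul, ← integral_const_mul]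
    simp only [Submodule.coe_smul, Pi.smul_apply, real_inner_smul_right]

/-! ### Finite dimension of the two spaces -/

-- Choosing one tetrahedron through each point of Ω gives a linear map from families of cubics to
-- functions, and its range contains every conforming function.
open Classical in
instance finiteDimensional_conformingP3 : FiniteDimensional ℝ M.conformingP3 := by
  choose τ hτ using fun (x : E3) (hx : x ∈ Ω) => M.exists_tet_of_mem hx
  set L : (Fin M.nt → Fin 3 → MvPolynomial.restrictTotalDegree (Fin 3) ℝ 3) →ₗ[ℝ] (E3 → E3) :=
    { toFun := fun q x => if hx : x ∈ Ω then
        WithLp.toLp 2 fun m => MvPolynomial.eval (fun k => x k)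
          (q (τ x hx) m : MvPolynomial (Fin 3) ℝ) else 0
      map_add' := fun q q' => by
        ext x m
        by_cases hx : x ∈ Ω <;> simp [hx]
      map_smul' := fun c q => by
        ext x m
        by_cases hx : x ∈ Ω <;> simp [hx] } with hL
  refine Submodule.finiteDimensional_of_le (S₂ := LinearMap.range L) ?_
  rintro v ⟨-, hv0, hvp⟩
  choose q hq hqe using hvp
  refine ⟨fun T m => ⟨q T m, hq T m⟩, ?_⟩
  ext x m
  by_cases hx : x ∈ Ω
  · simp [hL, hx, hqe (τ x hx) m x (hτ x hx)]
  · simp [hL, hx, hv0 x hx]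

instance finiteDimensional_velocitySpace : FiniteDimensional ℝ M.velocitySpace := by
  have := FiniteDimensional.span_of_finite ℝ
    (Set.finite_range fun Ti : Fin M.nt × Fin 9 => M.bubble Ti.1 Ti.2)
  exact Submodule.finiteDimensional_sup _ _

/-- The relation "this L² class is piecewise given by these polynomials" is a subspace `G`. It
projects injectively to the polynomial families, hence is finite-dimensional, and its other
projection contains the pressure space. -/
instance finiteDimensional_pressureSpace : FiniteDimensional ℝ M.pressureSpace := by
  set G : Submodule ℝ ((Fin M.nt → MvPolynomial.restrictTotalDegree (Fin 3) ℝ 2) ×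
      Lp ℝ 2 (volume.restrict Ω)) :=
    { carrier := {qp | ∀ T, ∀ᵐ x ∂(volume.restrict Ω), x ∈ M.tet T →
        qp.2 x = MvPolynomial.eval (fun k => x k) (qp.1 T : MvPolynomial (Fin 3) ℝ)}
      zero_mem' := fun T => by
        filter_upwards [Lp.coeFn_zero ℝ 2 (volume.restrict Ω)] with x hx _
        exact hx.trans (by simp)
      add_mem' := fun {a b} ha hb T => by
        filter_upwards [Lp.coeFn_add a.2 b.2, ha T, hb T] with x hx h1 h2 hxT
        exact hx.trans (by simp [h1 hxT, h2 hxT])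
      smul_mem' := fun c a ha T => by
        filter_upwards [Lp.coeFn_smul c a.2, ha T] with x hx h1 hxT
        exact hx.trans (by simp [h1 hxT]) } with hG
  have hinj : Function.Injective (LinearMap.fst ℝ _ _ ∘ₗ G.subtype) := by
    rw [injective_iff_map_eq_zero]
    rintro ⟨⟨q, p⟩, h⟩ h0
    have hq : q = 0 := h0
    subst hq
    have hp : p = 0 := by
      refine Lp.ext ?_
      filter_upwards [ae_all_iff.2 h, Lp.coeFn_zero ℝ 2 (volume.restrict Ω),
        ae_restrict_of_ae_restrict_of_subset subset_closure
          (ae_restrict_mem (isClosed_closure (s := Ω)).measurableSet)] with x hx hx0 hxΩ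
      rw [← M.iUnion_tet, Set.mem_iUnion] at hxΩ
      obtain ⟨T, hT⟩ := hxΩ
      rw [hx T hT, hx0]
      simp
    subst hp
    rfl
  have : FiniteDimensional ℝ G := Module.Finite.of_injective _ hinj
  refine Submodule.finiteDimensional_of_le (S₂ := G.map (LinearMap.snd ℝ _ _)) ?_
  rintro p ⟨-, hp⟩
  choose q hq hqe using hp
  exact ⟨(fun T => ⟨q T, hq T⟩, p), hqe, rfl⟩

end TetMesh

/-! ### Definiteness of the broken gradient form -/

namespace TetMesh

variable {Ω : Set E3} (M : TetMesh Ω)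

theorem gradInnerAt_self_nonneg (v : E3 → E3) (x : E3) : 0 ≤ gradInnerAt v v x :=
  Finset.sum_nonneg fun _ _ => Finset.sum_nonneg fun _ _ => mul_self_nonneg _

theorem exists_const_of_gradForm_self {u : E3 → E3} (hu : u ∈ M.velocitySpace)
    (h : M.gradForm u u = 0) (T : Fin M.nt) : ∃ c, ∀ x ∈ interior (M.tet T), u x = c := by
  have hT : ∫ x in interior (M.tet T), gradInnerAt u u x = 0 :=
    (Finset.sum_eq_zero_iff_of_nonneg fun S _ =>
      integral_nonneg (gradInnerAt_self_nonneg u)).1 h T (Finset.mem_univ T)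
  obtain ⟨g, hg, hug⟩ := M.exists_contDiff_eqOn hu T
  have hgu : Set.EqOn (gradInnerAt u u) (gradInnerAt g g) (interior (M.tet T)) := fun x hx => by
    simp only [gradInnerAt, M.fderiv_eq_of_eqOn hug hx]
  have hae := (setIntegral_eq_zero_iff_of_nonneg_ae (.of_forall (gradInnerAt_self_nonneg u))
    (M.integrableOn_gradInnerAt hu hu T)).1 hT
  have hae' : gradInnerAt g g =ᵐ[volume.restrict (interior (M.tet T))] 0 :=
    (hgu.aeEq_restrict isOpen_interior.measurableSet).symm.trans hae
  -- The gradient vanishes almost everywhere, hence by continuity everywhere on the open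
  -- tetrahedron.
  have hzero := Measure.eqOn_open_of_ae_eq hae' isOpen_interior
    (hg.continuous_gradInnerAt hg).continuousOn continuousOn_const
  obtain ⟨c, hc⟩ := isOpen_interior.exists_is_const_of_fderiv_eq_zero
    ((M.convex_tet T).interior).isPreconnected (hg.differentiable one_ne_zero).differentiableOn
    (fun x hx => fderiv_eq_zero_of_gradInnerAt_self (hzero hx))
  exact ⟨c, fun x hx => (hug hx).trans (hc x hx)⟩

/-- Otherwise Ω would be clopen and nonempty, hence all of space, although its closure is compact.
-/
theorem exists_mem_closure_diff {Ω : Set E3} (M : TetMesh Ω) (hconn : IsConnected Ω)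
    (hreg : interior (closure Ω) = Ω) : ∃ x ∈ closure Ω, x ∉ Ω := by
  by_contra! h
  have hopen : IsOpen Ω := hreg ▸ isOpen_interior
  have hcl : closure Ω = Ω := Set.Subset.antisymm h subset_closure
  have huniv : Ω = Set.univ :=
    IsClopen.eq_univ ⟨closure_eq_iff_isClosed.1 hcl, hopen⟩ hconn.nonempty
  have hc := M.isCompact_closure
  rw [hcl, huniv] at hc
  exact noncompact_univ E3 hc

/-- The form `(∇u, ∇u)` is definite on the velocity space. -/
theorem eq_zero_of_gradForm_self (hconn : IsConnected Ω) (hreg : interior (closure Ω) = Ω)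
    {u : E3 → E3} (hu : u ∈ M.velocitySpace) (h : M.gradForm u u = 0) : u = 0 := by
  choose c hc using M.exists_const_of_gradForm_self hu h
  obtain ⟨vc, ⟨hcont, hbd, hp⟩, d, rfl⟩ := M.mem_velocitySpace_iff.1 hu
  -- On each tetrahedron the bubble part is a constant minus the conforming part, hence cubic.
  have hd : ∀ T i, d T i = 0 := by
    intro T
    choose q hq hqe using hp T
    refine (M.basis T).bubble_coeff_eq_zero (q := fun m => MvPolynomial.C (c T m) - q m)
      (fun m => Submodule.sub_mem _ ?_ (hq m)) fun x hx m => ?_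
    · rw [MvPolynomial.mem_restrictTotalDegree, MvPolynomial.totalDegree_C]
      exact Nat.zero_le _
    · have h1 := hc T x hx
      rw [Pi.add_apply, M.sum_bubble_apply d hx] at h1
      rw [← h1, map_sub, MvPolynomial.eval_C, ← hqe m x (interior_subset hx), PiLp.add_apply]
      ring
  have hsum : ∑ T, ∑ i, d T i • M.bubble T i = 0 :=
    Finset.sum_eq_zero fun T _ => Finset.sum_eq_zero fun i _ => by rw [hd, zero_smul]
  rw [hsum, add_zero] at hc ⊢
  have hcT : ∀ T, ∀ x ∈ M.tet T, vc x = c T := fun T =>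
    Set.EqOn.of_subset_closure (hc T) (hcont.mono (M.tet_subset T)) continuousOn_const
      interior_subset (M.closure_interior_tet T).symm.subset
  have hne : ∀ T, (closure Ω ∩ M.tet T).Nonempty := fun T => by
    obtain ⟨x, hx⟩ := M.nonempty_interior_tet T
    exact ⟨x, M.tet_subset T (interior_subset hx), interior_subset hx⟩
  have hcc : ∀ T T', c T = c T' := fun T T' =>
    hconn.closure.isPreconnected.eq_of_closed_cover (fun S => (M.isCompact_tet S).isClosed)
      M.iUnion_tet.symm.subset
      (fun x _ S S' hS hS' => (hcT S x hS).symm.trans (hcT S' x hS')) (hne T) (hne T')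
  obtain ⟨x, hx, hxΩ⟩ := M.exists_mem_closure_diff hconn hreg
  rw [← M.iUnion_tet, Set.mem_iUnion] at hx
  obtain ⟨T₀, hT₀⟩ := hx
  have h0 : c T₀ = 0 := (hcT T₀ x hT₀).symm.trans (hbd x hxΩ)
  ext1 y
  by_cases hy : y ∈ Ω
  · obtain ⟨T, hT⟩ := M.exists_tet_of_mem hy
    rw [hcT T y hT, hcc T T₀, h0]
    rfl
  · exact hbd y hy

end TetMesh

/-! ### Face bubbles and pairs of tetrahedra with a common face -/

namespace AffineBasis

variable (b b' : AffineBasis (Fin 4) ℝ E3)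

theorem coord_eq_sum_coord (i : Fin 4) (y : E3) :
    b.coord i y = ∑ k, b'.coord k y * b.coord i (b' k) := by
  have h1 := b'.sum_coord_apply_eq_one y
  have h2 : ∀ k : Fin 3, (b.coord i).linear (b' k.succ - b' 0) =
      b.coord i (b' k.succ) - b.coord i (b' 0) := fun k => by
    rw [← vsub_eq_sub, AffineMap.linearMap_vsub, vsub_eq_sub]
  conv_lhs => rw [b'.eq_add_sum_coord y, coord_add_vec, map_sum]
  simp only [map_smul, h2, smul_eq_mul]
  rw [Fin.sum_univ_succ (n := 3)] at h1 ⊢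
  rw [eq_sub_of_add_eq h1]
  simp only [mul_sub, Finset.sum_sub_distrib, ← Finset.sum_mul]
  ring

/-- The product of the barycentric coordinates of the face opposite to the vertex `3`. -/
noncomputable def faceBubble (x : E3) : ℝ := b.coord 0 x * b.coord 1 x * b.coord 2 x

theorem contDiff_faceBubble {n : WithTop ℕ∞} : ContDiff ℝ n b.faceBubble :=
  ((b.contDiff_coord 0).mul (b.contDiff_coord 1)).mul (b.contDiff_coord 2)

theorem exists_polynomial_coord (i : Fin 4) :
    ∃ q : MvPolynomial (Fin 3) ℝ, q.totalDegree ≤ 1 ∧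
      ∀ x : E3, MvPolynomial.eval (fun k => x k) q = b.coord i x := by
  refine ⟨MvPolynomial.C (b.coord i 0) + ∑ k : Fin 3,
    MvPolynomial.C ((b.coord i).linear (EuclideanSpace.single k 1)) * MvPolynomial.X k, ?_,
    fun x => ?_⟩
  · refine (MvPolynomial.totalDegree_add _ _).trans (max_le (by simp) ?_)
    refine MvPolynomial.totalDegree_finsetSum_le fun k _ => ?_
    refine (MvPolynomial.totalDegree_mul _ _).trans ?_
    rw [MvPolynomial.totalDegree_C, MvPolynomial.totalDegree_X]
  · have hx : x = ∑ k, x k • EuclideanSpace.single k (1 : ℝ) := by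
      ext m
      simp [Pi.single_apply]
    have h := b.coord_add_vec i 0 x
    rw [zero_add] at h
    rw [h]
    conv_rhs => rw [hx, map_sum]
    simp [mul_comm]

theorem exists_polynomial_faceBubble (c : ℝ) :
    ∃ q ∈ MvPolynomial.restrictTotalDegree (Fin 3) ℝ 3,
      ∀ x : E3, b.faceBubble x * c = MvPolynomial.eval (fun k => x k) q := by
  choose q hq hqe using b.exists_polynomial_coord
  refine ⟨q 0 * q 1 * q 2 * MvPolynomial.C c, ?_, fun x => ?_⟩
  · rw [MvPolynomial.mem_restrictTotalDegree]
    have h1 := MvPolynomial.totalDegree_mul (q 0 * q 1 * q 2) (MvPolynomial.C c)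
    have h2 := MvPolynomial.totalDegree_mul (q 0 * q 1) (q 2)
    have h3 := MvPolynomial.totalDegree_mul (q 0) (q 1)
    rw [MvPolynomial.totalDegree_C] at h1
    linarith [hq 0, hq 1, hq 2]
  · simp [faceBubble, hqe]

theorem integral_coord_param_mul :
    (∫ s in cornerSimplex 3 1, s 0 * s 1 = 1 / 120) ∧
    (∫ s in cornerSimplex 3 1, (1 - ∑ k, s k) * s 0 = 1 / 120) ∧
    (∫ s in cornerSimplex 3 1, (1 - ∑ k, s k) * s 1 = 1 / 120) := by
  refine ⟨?_, ?_, ?_⟩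
  · have h := integral_sum_monomials_refTet [(1, 1, 1, 0)]
    simp only [List.map_cons, List.map_nil, List.sum_cons, List.sum_nil] at h
    refine Eq.trans (integral_congr_ae (.of_forall fun s => ?_)) (h.trans ?_)
    · simp only []; ring
    · norm_num [Nat.factorial]
  · have h := integral_sum_monomials_refTet
      [(1, 1, 0, 0), (-1, 2, 0, 0), (-1, 1, 1, 0), (-1, 1, 0, 1)]
    simp only [List.map_cons, List.map_nil, List.sum_cons, List.sum_nil] at h
    refine Eq.trans (integral_congr_ae (.of_forall fun s => ?_)) (h.trans ?_)
    · simp only [Fin.sum_univ_three]; ring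
    · norm_num [Nat.factorial]
  · have h := integral_sum_monomials_refTet
      [(1, 0, 1, 0), (-1, 1, 1, 0), (-1, 0, 2, 0), (-1, 0, 1, 1)]
    simp only [List.map_cons, List.map_nil, List.sum_cons, List.sum_nil] at h
    refine Eq.trans (integral_congr_ae (.of_forall fun s => ?_)) (h.trans ?_)
    · simp only [Fin.sum_univ_three]; ring
    · norm_num [Nat.factorial]

theorem divAt_faceBubble_smul (w x : E3) : divAt (fun y => b.faceBubble y • w) x =
    (b.coord 0).linear w * (b.coord 1 x * b.coord 2 x)
      + (b.coord 1).linear w * (b.coord 0 x * b.coord 2 x)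
      + (b.coord 2).linear w * (b.coord 0 x * b.coord 1 x) := by
  have hd : DifferentiableAt ℝ b.faceBubble x :=
    (b.contDiff_faceBubble.differentiable one_ne_zero).differentiableAt
  have h := divAt_sum_smul (ι := Fin 1) (φ := fun _ => b.faceBubble) (w := fun _ => w) (x := x)
    (fun _ => hd)
  simp only [Finset.univ_unique, Finset.sum_singleton] at h
  rw [h, ← hd.lineDeriv_eq_fderiv, lineDeriv]
  have hf : ∀ (i : Fin 4), HasDerivAt (fun t : ℝ => b.coord i (x + t • w))
      ((b.coord i).linear w) 0 := fun i => by
    simp only [coord_add_vec, map_smul, smul_eq_mul]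
    simpa using ((hasDerivAt_id' (0 : ℝ)).mul_const ((b.coord i).linear w)).const_add (b.coord i x)
  have := ((hf 0).fun_mul (hf 1)).fun_mul (hf 2)
  simp only [zero_smul, add_zero] at this
  refine this.deriv.trans ?_
  ring

/-- The three products of coordinates have the same integral, and the four coordinate derivatives
sum to zero, so only the derivative of λ₃ survives. -/
theorem setIntegral_divAt_faceBubble_smul (w : E3) :
    ∫ x in interior (convexHull ℝ (Set.range b)), divAt (fun y => b.faceBubble y • w) x =
      -(|(jacobiMatrix b).det| * (b.coord 3).linear w / 120) := by
  simp_rw [divAt_faceBubble_smul]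
  have hc := b.continuous_coord'
  rw [setIntegral_interior_convexHull b (by fun_prop)]
  have h0 := b.coord_zero_param
  have h1 : ∀ s, b.coord 1 (b.param s) = s 0 := fun s => b.coord_param s 0
  have h2 : ∀ s, b.coord 2 (b.param s) = s 1 := fun s => b.coord_param s 1
  simp only [h0, h1, h2]
  rw [integral_add, integral_add, integral_const_mul, integral_const_mul, integral_const_mul,
    integral_coord_param_mul.1, integral_coord_param_mul.2.1, integral_coord_param_mul.2.2]
  · have hs : ∑ i, (b.coord i).linear w = 0 := by
      have e1 := b.sum_coord_apply_eq_one w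
      have e0 := b.sum_coord_apply_eq_one 0
      have e : ∀ i, (b.coord i).linear w = b.coord i w - b.coord i 0 := fun i => by
        have := b.coord_add_vec i 0 w
        rw [zero_add] at this
        linarith
      simp only [e, Finset.sum_sub_distrib, e1, e0, sub_self]
    rw [Fin.sum_univ_four] at hs
    linear_combination |(jacobiMatrix b).det| / 120 * hs
  all_goals exact Continuous.integrableOn_cornerSimplex (by fun_prop)

variable {b b'}

/-- Both sides are affine and vanish at the three shared vertices, so they are proportional; the
value at `b' 3` fixes the factor. -/
theorem coord_three_eq (hface : ∀ i, i ≠ 3 → b i = b' i) (y : E3) :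
    b.coord 3 y = b.coord 3 (b' 3) * b'.coord 3 y := by
  rw [b.coord_eq_sum_coord b' 3 y, Fin.sum_univ_four, ← hface 0 (by decide),
    ← hface 1 (by decide), ← hface 2 (by decide), b.coord_apply_ne (by decide),
    b.coord_apply_ne (by decide), b.coord_apply_ne (by decide)]
  ring

theorem coord_eq_of_ne_three (hface : ∀ i, i ≠ 3 → b i = b' i) {i : Fin 4} (hi : i ≠ 3) (y : E3) :
    b.coord i y = b'.coord i y + b'.coord 3 y * b.coord i (b' 3) := by
  rw [b.coord_eq_sum_coord b' i y, Fin.sum_univ_four, ← hface 0 (by decide),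
    ← hface 1 (by decide), ← hface 2 (by decide), b.coord_apply, b.coord_apply, b.coord_apply]
  fin_cases i <;> simp_all

theorem coord_three_mul_coord_three (hface : ∀ i, i ≠ 3 → b i = b' i) :
    b.coord 3 (b' 3) * b'.coord 3 (b 3) = 1 := by
  rw [← coord_three_eq hface, b.coord_apply_eq]

/-- Two tetrahedra that meet only in a common face lie on opposite sides of it. -/
theorem coord_three_neg (hface : ∀ i, i ≠ 3 → b i = b' i)
    (hinter : ∀ x ∈ convexHull ℝ (Set.range b), x ∈ convexHull ℝ (Set.range b') →
      b.coord 3 x = 0) : b.coord 3 (b' 3) < 0 := by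
  have hne : b.coord 3 (b' 3) ≠ 0 := left_ne_zero_of_mul_eq_one (coord_three_mul_coord_three hface)
  refine lt_of_le_of_ne (le_of_not_gt fun hpos => ?_) hne
  set K := |b.coord 0 (b' 3)| + |b.coord 1 (b' 3)| + |b.coord 2 (b' 3)| with hK
  have hK0 : 0 ≤ K := by positivity
  -- This choice makes (1 - ε)/3 = ε K. The point with `b'`-weights (1 - ε)/3 on the face and ε on
  -- `b' 3` then has nonnegative `b`-coordinates 0, 1, 2. If the factor were positive, it would lie
  -- in both tetrahedra but off the face.
  set ε : ℝ := 1 / (1 + 3 * K) with hε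
  have hε0 : 0 < ε := by positivity
  have hεK : ε * (1 + 3 * K) = 1 := by
    rw [hε]
    field_simp
  have hε1 : ε ≤ 1 := by nlinarith
  set y := b'.param ![(1 - ε) / 3, (1 - ε) / 3, ε] with hy
  have c1 : b'.coord 1 y = (1 - ε) / 3 := b'.coord_param _ 0
  have c2 : b'.coord 2 y = (1 - ε) / 3 := b'.coord_param _ 1
  have c3 : b'.coord 3 y = ε := b'.coord_param _ 2
  have c0 : b'.coord 0 y = (1 - ε) / 3 := by
    rw [hy, coord_zero_param, Fin.sum_univ_three]
    simp
    ring
  have e3 := coord_three_eq hface y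
  rw [c3] at e3
  have hb : ∀ i, i ≠ 3 → b'.coord i y = (1 - ε) / 3 → |b.coord i (b' 3)| ≤ K →
      0 ≤ b.coord i y := by
    intro i hi hci hcK
    rw [coord_eq_of_ne_three hface hi, hci, c3]
    have := (abs_le.1 hcK).1
    nlinarith
  have hmem : y ∈ convexHull ℝ (Set.range b) := by
    rw [b.convexHull_eq_nonneg_coord]
    intro i
    fin_cases i
    · refine hb 0 (by decide) c0 ?_
      linarith [abs_nonneg (b.coord 1 (b' 3)), abs_nonneg (b.coord 2 (b' 3))]
    · refine hb 1 (by decide) c1 ?_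
      linarith [abs_nonneg (b.coord 0 (b' 3)), abs_nonneg (b.coord 2 (b' 3))]
    · refine hb 2 (by decide) c2 ?_
      linarith [abs_nonneg (b.coord 0 (b' 3)), abs_nonneg (b.coord 1 (b' 3))]
    · exact e3.symm ▸ by positivity
  have hmem' : y ∈ convexHull ℝ (Set.range b') := by
    rw [b'.convexHull_eq_nonneg_coord]
    intro i
    fin_cases i
    · exact c0.symm ▸ by linarith
    · exact c1.symm ▸ by linarith
    · exact c2.symm ▸ by linarith
    · exact c3.symm ▸ hε0.le
  have := hinter y hmem hmem'
  rw [e3] at this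
  exact (mul_pos hpos hε0).ne' this

/-- In the coordinates of `b`, the edge matrix of `b'` is triangular: two columns are unit vectors
and the last diagonal entry is the factor. -/
theorem det_jacobiMatrix_of_face (hface : ∀ i, i ≠ 3 → b i = b' i) :
    (jacobiMatrix b').det = (jacobiMatrix b).det * b.coord 3 (b' 3) := by
  have hcol : ∀ y : E3, Matrix.mulVec (jacobiMatrix b) (fun k => b.coord k.succ y) =
      WithLp.ofLp (y - b 0) := fun y => by
    conv_rhs => rw [← b.param_coord y, param_eq]
    simp
  have hmul : jacobiMatrix b' =
      jacobiMatrix b * Matrix.of fun (k j : Fin 3) => b.coord k.succ (b' j.succ) := by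
    ext m j
    have := congrFun (hcol (b' j.succ)) m
    rw [hface 0 (by decide)] at this
    exact this.symm
  have a1 : b' (Fin.succ 0) = b 1 := (hface 1 (by decide)).symm
  have a2 : b' (Fin.succ 1) = b 2 := (hface 2 (by decide)).symm
  have hdet : (Matrix.of fun (k j : Fin 3) => b.coord k.succ (b' j.succ)).det =
      b.coord 3 (b' 3) := by
    rw [Matrix.det_fin_three]
    simp only [Matrix.of_apply, a1, a2, b.coord_apply]
    simp [show (0 : Fin 3).succ = (1 : Fin 4) from rfl,
      show (1 : Fin 3).succ = (2 : Fin 4) from rfl, show (2 : Fin 3).succ = (3 : Fin 4) from rfl]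
  rw [hmul, Matrix.det_mul, hdet]

end AffineBasis

/-! ### Equality of the pressure constants across a face -/

namespace TetMesh

variable {Ω : Set E3} (M : TetMesh Ω)

theorem tet_eq_of_range {T : Fin M.nt} {b : AffineBasis (Fin 4) ℝ E3}
    (hb : Set.range b = Set.range (M.vertex T)) : M.tet T = convexHull ℝ (Set.range b) := by
  rw [tet, hb]

theorem mem_tet_iff_of_range {T : Fin M.nt} {b : AffineBasis (Fin 4) ℝ E3}
    (hb : Set.range b = Set.range (M.vertex T)) {x : E3} :
    x ∈ M.tet T ↔ ∀ i, 0 ≤ b.coord i x := by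
  rw [M.tet_eq_of_range hb, b.convexHull_eq_nonneg_coord]
  rfl

/-- If three vertices of one tetrahedron are vertices of another one, then the other one can be
numbered compatibly. -/
theorem exists_basis_of_face {b : AffineBasis (Fin 4) ℝ E3} {S : Fin M.nt}
    (h : ∀ i, i ≠ 3 → b i ∈ Set.range (M.vertex S)) :
    ∃ b' : AffineBasis (Fin 4) ℝ E3, Set.range b' = Set.range (M.vertex S) ∧
      ∀ i, i ≠ 3 → b i = b' i := by
  choose! j hj using h
  obtain ⟨k, hk⟩ : ∃ k, k ∉ ({j 0, j 1, j 2} : Finset (Fin 4)) := by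
    by_contra! hall
    have h1 : (Finset.univ : Finset (Fin 4)) ⊆ {j 0, j 1, j 2} := fun k _ => hall k
    have h2 := Finset.card_le_card h1
    have h3 := Finset.card_le_three (a := j 0) (b := j 1) (c := j 2)
    simp at h2
    omega
  simp only [Finset.mem_insert, Finset.mem_singleton, not_or] at hk
  have hjne : ∀ i l, i ≠ 3 → l ≠ 3 → i ≠ l → j i ≠ j l := fun i l hi hl hil he =>
    hil (b.ind.injective (by rw [← hj i hi, ← hj l hl, he]))
  have h01 := hjne 0 1 (by decide) (by decide) (by decide)
  have h02 := hjne 0 2 (by decide) (by decide) (by decide)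
  have h12 := hjne 1 2 (by decide) (by decide) (by decide)
  have hinj : Function.Injective ![j 0, j 1, j 2, k] := by
    intro i l hil
    fin_cases i <;> fin_cases l <;> simp_all [eq_comm]
  have hbij : Function.Bijective ![j 0, j 1, j 2, k] := Finite.injective_iff_bijective.1 hinj
  refine ⟨(M.basis S).renumber hbij, (M.basis S).range_renumber hbij, fun i hi => ?_⟩
  rw [AffineBasis.coe_renumber, ← hj i hi, coe_basis]
  fin_cases i <;> simp_all

section Face

variable {M} {T T' : Fin M.nt} {b b' : AffineBasis (Fin 4) ℝ E3}

/-- Some vertex of T is unshared, and since the other three are shared it must be number 3. -/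
theorem coord_three_eq_zero (hne : T ≠ T')
    (hb : Set.range b = Set.range (M.vertex T)) (hb' : Set.range b' = Set.range (M.vertex T'))
    (hface : ∀ i, i ≠ 3 → b i = b' i) {x : E3} (hx : x ∈ M.tet T) (hx' : x ∈ M.tet T') :
    b.coord 3 x = 0 := by
  refine M.coord_eq_zero_of_mem_inter hne hb (fun h3 => ?_) hx hx'
  obtain ⟨i, hi⟩ := M.exists_vertex_notMem hne
  obtain ⟨k, hk⟩ : M.vertex T i ∈ Set.range b := hb ▸ ⟨i, rfl⟩
  rw [← hk] at hi
  by_cases hk3 : k = 3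
  · exact hi (hk3 ▸ h3)
  · exact hi (hb' ▸ ⟨k, (hface k hk3).symm⟩)

theorem coord_three_vertex_neg (hne : T ≠ T')
    (hb : Set.range b = Set.range (M.vertex T)) (hb' : Set.range b' = Set.range (M.vertex T'))
    (hface : ∀ i, i ≠ 3 → b i = b' i) : b.coord 3 (b' 3) < 0 :=
  AffineBasis.coord_three_neg hface fun x hx hx' => coord_three_eq_zero hne hb hb' hface
    (by rwa [M.tet_eq_of_range hb]) (by rwa [M.tet_eq_of_range hb'])

theorem coord_eq_of_mem_inter (hne : T ≠ T')
    (hb : Set.range b = Set.range (M.vertex T)) (hb' : Set.range b' = Set.range (M.vertex T'))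
    (hface : ∀ i, i ≠ 3 → b i = b' i) {x : E3} (hx3 : b.coord 3 x = 0) (i : Fin 4) :
    b.coord i x = b'.coord i x := by
  have h := AffineBasis.coord_three_eq hface x
  have hr := coord_three_vertex_neg hne hb hb' hface
  have h3 : b'.coord 3 x = 0 := by
    rw [hx3] at h
    exact (mul_eq_zero.1 h.symm).resolve_left hr.ne
  by_cases hi : i = 3
  · rw [hi, hx3, h3]
  · rw [AffineBasis.coord_eq_of_ne_three hface hi, h3, zero_mul, add_zero]

/-- No three tetrahedra share a face. -/
theorem exists_face_vertex_notMem (hne : T ≠ T')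
    (hb : Set.range b = Set.range (M.vertex T)) (hb' : Set.range b' = Set.range (M.vertex T'))
    (hface : ∀ i, i ≠ 3 → b i = b' i) {S : Fin M.nt} (hST : S ≠ T) (hST' : S ≠ T') :
    ∃ i, i ≠ 3 ∧ b i ∉ Set.range (M.vertex S) := by
  by_contra! hall
  obtain ⟨b'', hb'', hf⟩ := M.exists_basis_of_face hall
  have hf' : ∀ i, i ≠ 3 → b' i = b'' i := fun i hi => (hface i hi).symm.trans (hf i hi)
  have h1 := coord_three_vertex_neg hne hb hb' hface
  have h2 := coord_three_vertex_neg hST.symm hb hb'' hf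
  have h3 := coord_three_vertex_neg hST'.symm hb' hb'' hf'
  -- The factors multiply along `b`, `b'`, `b''`, so the three cannot all be negative.
  rw [AffineBasis.coord_three_eq hface] at h2
  exact absurd h2 (mul_pos_of_neg_of_neg h1 h3).le.not_gt

variable (M T T' b b') in
open Classical in
/-- The cubic bubble of the common face of two tetrahedra, times a vector. -/
noncomputable def faceField (w : E3) (x : E3) : E3 :=
  if x ∈ M.tet T then b.faceBubble x • w else if x ∈ M.tet T' then b'.faceBubble x • w else 0

theorem faceField_of_mem {w x : E3} (hx : x ∈ M.tet T) :
    M.faceField T T' b b' w x = b.faceBubble x • w := if_pos hx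

theorem faceField_of_mem' (hne : T ≠ T')
    (hb : Set.range b = Set.range (M.vertex T)) (hb' : Set.range b' = Set.range (M.vertex T'))
    (hface : ∀ i, i ≠ 3 → b i = b' i) {w x : E3} (hx' : x ∈ M.tet T') :
    M.faceField T T' b b' w x = b'.faceBubble x • w := by
  by_cases hx : x ∈ M.tet T
  · rw [faceField_of_mem hx]
    have h := coord_eq_of_mem_inter hne hb hb' hface (coord_three_eq_zero hne hb hb' hface hx hx')
    simp only [AffineBasis.faceBubble, h]
  · rw [faceField, if_neg hx, if_pos hx']

theorem faceBubble_eq_zero {x : E3} {i : Fin 4} (hi : i ≠ 3) (h : b.coord i x = 0) :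
    b.faceBubble x = 0 := by
  unfold AffineBasis.faceBubble
  fin_cases i <;> simp_all

theorem faceField_of_mem_other (hne : T ≠ T')
    (hb : Set.range b = Set.range (M.vertex T)) (hb' : Set.range b' = Set.range (M.vertex T'))
    (hface : ∀ i, i ≠ 3 → b i = b' i) {S : Fin M.nt} (hST : S ≠ T) (hST' : S ≠ T') {w x : E3}
    (hx : x ∈ M.tet S) : M.faceField T T' b b' w x = 0 := by
  obtain ⟨i, hi, hiS⟩ := exists_face_vertex_notMem hne hb hb' hface hST hST'
  by_cases hxT : x ∈ M.tet T
  · rw [faceField_of_mem hxT,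
      faceBubble_eq_zero hi (M.coord_eq_zero_of_mem_inter hST.symm hb hiS hxT hx), zero_smul]
  by_cases hxT' : x ∈ M.tet T'
  · rw [hface i hi] at hiS
    rw [faceField_of_mem' hne hb hb' hface hxT',
      faceBubble_eq_zero hi (M.coord_eq_zero_of_mem_inter hST'.symm hb' hiS hxT' hx), zero_smul]
  · rw [faceField, if_neg hxT, if_neg hxT']

/-- The points with positive face coordinates in both numberings form an open set. The sign of λ₃
puts each of them in T or T', so this set lies in the interior of closure Ω, which is Ω. Relative
interior points of a shared face are therefore not boundary points. -/
theorem mem_of_face_coord_pos (hreg : interior (closure Ω) = Ω) (hne : T ≠ T')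
    (hb : Set.range b = Set.range (M.vertex T)) (hb' : Set.range b' = Set.range (M.vertex T'))
    (hface : ∀ i, i ≠ 3 → b i = b' i) {x : E3} (hx : ∀ i, i ≠ 3 → 0 < b.coord i x)
    (hx' : ∀ i, i ≠ 3 → 0 < b'.coord i x) : x ∈ Ω := by
  set U : Set E3 := ⋂ i : {i : Fin 4 // i ≠ 3},
    ({y | 0 < b.coord i y} ∩ {y | 0 < b'.coord i y}) with hU
  have hUo : IsOpen U := isOpen_iInter_of_finite fun i =>
    (isOpen_lt continuous_const (b.continuous_coord' i)).inter
      (isOpen_lt continuous_const (b'.continuous_coord' i))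
  have hUs : U ⊆ closure Ω := by
    intro y hy
    have hy1 : ∀ i, i ≠ 3 → 0 < b.coord i y := fun i hi => (Set.mem_iInter.1 hy ⟨i, hi⟩).1
    have hy2 : ∀ i, i ≠ 3 → 0 < b'.coord i y := fun i hi => (Set.mem_iInter.1 hy ⟨i, hi⟩).2
    by_cases h3 : 0 ≤ b.coord 3 y
    · refine M.tet_subset T ((M.mem_tet_iff_of_range hb).2 fun i => ?_)
      by_cases hi : i = 3
      · exact hi ▸ h3
      · exact (hy1 i hi).le
    · refine M.tet_subset T' ((M.mem_tet_iff_of_range hb').2 fun i => ?_)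
      by_cases hi : i = 3
      · rw [AffineBasis.coord_three_eq hface] at h3
        have hr := coord_three_vertex_neg hne hb hb' hface
        subst hi
        by_contra hc
        exact h3 (mul_nonneg_of_nonpos_of_nonpos hr.le (not_le.1 hc).le)
      · exact (hy2 i hi).le
  rw [← hreg]
  exact interior_maximal hUs hUo (Set.mem_iInter.2 fun i => ⟨hx i i.2, hx' i i.2⟩)

/-- This provides the zero boundary values of the face field. -/
theorem mem_of_faceBubble_ne_zero (hreg : interior (closure Ω) = Ω) (hne : T ≠ T')
    (hb : Set.range b = Set.range (M.vertex T)) (hb' : Set.range b' = Set.range (M.vertex T'))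
    (hface : ∀ i, i ≠ 3 → b i = b' i) {x : E3} (hx : x ∈ M.tet T) (h : b.faceBubble x ≠ 0) :
    x ∈ Ω := by
  have hnn := (M.mem_tet_iff_of_range hb).1 hx
  have hpos : ∀ i, i ≠ 3 → 0 < b.coord i x := fun i hi =>
    lt_of_le_of_ne (hnn i) fun h0 => h (faceBubble_eq_zero hi h0.symm)
  rcases (hnn 3).lt_or_eq with h3 | h3
  · refine M.interior_tet_subset hreg T ?_
    rw [M.tet_eq_of_range hb, b.interior_convexHull]
    intro i
    by_cases hi : i = 3
    · exact hi ▸ h3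
    · exact hpos i hi
  · exact mem_of_face_coord_pos hreg hne hb hb' hface hpos fun i hi =>
      coord_eq_of_mem_inter hne hb hb' hface h3.symm i ▸ hpos i hi

theorem faceField_mem_conformingP3 (hreg : interior (closure Ω) = Ω) (hne : T ≠ T')
    (hb : Set.range b = Set.range (M.vertex T)) (hb' : Set.range b' = Set.range (M.vertex T'))
    (hface : ∀ i, i ≠ 3 → b i = b' i) (w : E3) : M.faceField T T' b b' w ∈ M.conformingP3 := by
  refine ⟨?_, fun x hx => ?_, fun S m => ?_⟩
  · rw [← M.iUnion_tet]
    refine (locallyFinite_of_finite _).continuousOn_iUnion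
      (fun S => (M.isCompact_tet S).isClosed) fun S => ?_
    by_cases hST : S = T
    · subst hST
      exact ((b.contDiff_faceBubble (n := 0)).continuous.smul
        continuous_const).continuousOn.congr fun x hx => faceField_of_mem hx
    by_cases hST' : S = T'
    · subst hST'
      exact ((b'.contDiff_faceBubble (n := 0)).continuous.smul
        continuous_const).continuousOn.congr fun x hx => faceField_of_mem' hne hb hb' hface hx
    · exact continuousOn_const.congr fun x hx =>
        faceField_of_mem_other hne hb hb' hface hST hST' hx
  · by_cases hxT : x ∈ M.tet T
    · rw [faceField_of_mem hxT]
      by_cases h : b.faceBubble x = 0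
      · rw [h, zero_smul]
      · exact absurd (mem_of_faceBubble_ne_zero hreg hne hb hb' hface hxT h) hx
    by_cases hxT' : x ∈ M.tet T'
    · rw [faceField_of_mem' hne hb hb' hface hxT']
      by_cases h : b'.faceBubble x = 0
      · rw [h, zero_smul]
      · exact absurd (mem_of_faceBubble_ne_zero hreg hne.symm hb' hb
          (fun i hi => (hface i hi).symm) hxT' h) hx
    · rw [faceField, if_neg hxT, if_neg hxT']
  · by_cases hST : S = T
    · subst hST
      obtain ⟨q, hq, hqe⟩ := b.exists_polynomial_faceBubble (w m)
      exact ⟨q, hq, fun x hx => by rw [faceField_of_mem hx, ← hqe]; rfl⟩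
    by_cases hST' : S = T'
    · subst hST'
      obtain ⟨q, hq, hqe⟩ := b'.exists_polynomial_faceBubble (w m)
      exact ⟨q, hq, fun x hx => by rw [faceField_of_mem' hne hb hb' hface hx, ← hqe]; rfl⟩
    · exact ⟨0, Submodule.zero_mem _, fun x hx => by
        rw [faceField_of_mem_other hne hb hb' hface hST hST' hx, map_zero]; rfl⟩

theorem setIntegral_divAt_faceBubble {w : E3} {v : E3 → E3} (c : ℝ)
    (hb : Set.range b = Set.range (M.vertex T))
    (hv : ∀ x ∈ M.tet T, v x = b.faceBubble x • w) :
    ∫ x in interior (M.tet T), divAt v x * c =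
      -(|(jacobiMatrix b).det| * (b.coord 3).linear w / 120) * c := by
  rw [integral_mul_const]
  congr 1
  rw [← b.setIntegral_divAt_faceBubble_smul w, ← M.tet_eq_of_range hb]
  refine setIntegral_congr_fun isOpen_interior.measurableSet fun x hx => ?_
  simp only [divAt]
  rw [M.fderiv_eq_of_eqOn (T := T) (g := fun y => b.faceBubble y • w)
    (fun y hy => hv y (interior_subset hy)) hx]

/-- A piecewise constant function that is orthogonal to the divergences of the conforming functions
has the same value on both sides of a face. -/
theorem const_eq_of_face (hreg : interior (closure Ω) = Ω) (hne : T ≠ T')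
    (hb : Set.range b = Set.range (M.vertex T)) (hb' : Set.range b' = Set.range (M.vertex T'))
    (hface : ∀ i, i ≠ 3 → b i = b' i) {p : E3 → ℝ} {c : Fin M.nt → ℝ}
    (hp : ∀ S, ∀ᵐ x ∂volume.restrict (interior (M.tet S)), p x = c S)
    (horth : ∀ v ∈ M.conformingP3, M.divForm v p = 0) : c T = c T' := by
  -- This vector crosses the face with unit λ₃-derivative.
  set w := b 3 - b 0 with hw
  have h := horth _ (faceField_mem_conformingP3 hreg hne hb hb' hface w)
  have hS : ∀ S, ∫ x in interior (M.tet S), divAt (M.faceField T T' b b' w) x * p x =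
      ∫ x in interior (M.tet S), divAt (M.faceField T T' b b' w) x * c S := fun S => by
    refine integral_congr_ae ?_
    filter_upwards [hp S] with x hx
    rw [hx]
  simp only [divForm, hS] at h
  rw [Fintype.sum_eq_add T T' hne, setIntegral_divAt_faceBubble _ hb fun x hx => faceField_of_mem hx,
    setIntegral_divAt_faceBubble _ hb' fun x hx => faceField_of_mem' hne hb hb' hface hx] at h
  · have h1 : (b.coord 3).linear w = 1 := by
      rw [hw, b.coord_linear_sub]
      simp
    have h2 : (b'.coord 3).linear w = b'.coord 3 (b 3) := by
      rw [hw, ← vsub_eq_sub, AffineMap.linearMap_vsub, vsub_eq_sub, hface 0 (by decide),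
        b'.coord_apply_ne (by decide), sub_zero]
    have hr := coord_three_vertex_neg hne hb hb' hface
    have hrr := AffineBasis.coord_three_mul_coord_three hface
    have hdet := b.det_jacobiMatrix_ne_zero
    rw [h1, h2, AffineBasis.det_jacobiMatrix_of_face hface, abs_mul, abs_of_neg hr] at h
    -- With r the negative factor between the third coordinates, the volume scales by -r from T to
    -- T' and the derivative of λ₃ by 1/r, so the two contributions have equal size and opposite
    -- sign.
    have h3 : |(jacobiMatrix b).det| * (c T' - c T) = 0 := by
      linear_combination 120 * h - |(jacobiMatrix b).det| * c T' * hrr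
    have := (mul_eq_zero.1 h3).resolve_left (abs_ne_zero.2 hdet)
    linarith
  · rintro S ⟨hST, hST'⟩
    rw [setIntegral_congr_fun (g := fun _ => (0 : ℝ)) isOpen_interior.measurableSet fun x hx => ?_]
    · simp
    · simp only [divAt]
      rw [M.fderiv_eq_of_eqOn (T := S) (g := fun _ => 0) (fun y hy =>
        faceField_of_mem_other hne hb hb' hface hST hST' (interior_subset hy)) hx]
      simp

end Face

end TetMesh

/-! ### Segments that avoid the edges, and the passage to a global constant -/

theorem volume_affineSpan_triple (p₁ p₂ p₃ : E3) :
    volume (affineSpan ℝ {p₁, p₂, p₃} : Set E3) = 0 := by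
  refine Measure.addHaar_affineSubspace _ _ fun htop => ?_
  have h2 : Module.rank ℝ (vectorSpan ℝ {p₁, p₂, p₃}) ≤ 2 := coplanar_triple ℝ p₁ p₂ p₃
  rw [← direction_affineSpan, htop, AffineSubspace.direction_top, rank_top,
    ← Module.finrank_eq_rank, finrank_euclideanSpace_fin] at h2
  norm_num at h2

theorem IsOpen.nonempty_diff_of_volume_eq_zero {U N : Set E3} (hU : IsOpen U) (hne : U.Nonempty)
    (hN : volume N = 0) : (U \ N).Nonempty := by
  have hpos : 0 < volume (U \ N) := by
    rw [measure_sdiff_null hN]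
    exact hU.measure_pos volume hne
  exact nonempty_of_measure_ne_zero hpos.ne'

namespace TetMesh

variable {Ω : Set E3} (M : TetMesh Ω)

/-- The union of the planes through a point and the edges of the grid. -/
def edgePlanes (y : E3) : Set E3 :=
  ⋃ S, ⋃ i, ⋃ j, (affineSpan ℝ {y, M.vertex S i, M.vertex S j} : Set E3)

/-- The union of the lines through the edges of the grid. -/
def edgeLines : Set E3 :=
  ⋃ S, ⋃ i, ⋃ j, (affineSpan ℝ {M.vertex S i, M.vertex S j} : Set E3)

theorem volume_edgePlanes (y : E3) : volume (M.edgePlanes y) = 0 :=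
  measure_iUnion_null fun _ => measure_iUnion_null fun _ => measure_iUnion_null fun _ =>
    volume_affineSpan_triple _ _ _

theorem volume_edgeLines : volume M.edgeLines = 0 := by
  refine measure_iUnion_null fun S => measure_iUnion_null fun i => measure_iUnion_null fun j => ?_
  have h := volume_affineSpan_triple (M.vertex S i) (M.vertex S i) (M.vertex S j)
  rwa [Set.insert_eq_of_mem (Set.mem_insert _ _)] at h

/-- If a point p ≠ y of the segment were on an edge line, z would lie on the line through y and p,
hence in the plane through y and that edge. -/
theorem notMem_edgeLines_of_mem_segment {y z p : E3} (hy : y ∉ M.edgeLines)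
    (hz : z ∉ M.edgePlanes y) (hp : p ∈ segment ℝ y z) : p ∉ M.edgeLines := by
  intro hpl
  simp only [edgeLines, Set.mem_iUnion] at hpl
  obtain ⟨S, i, j, hpl⟩ := hpl
  rw [segment_eq_image_lineMap] at hp
  obtain ⟨t, -, rfl⟩ := hp
  by_cases ht : t = 0
  · subst ht
    rw [AffineMap.lineMap_apply_zero] at hpl
    exact hy (Set.mem_iUnion.2 ⟨S, Set.mem_iUnion.2 ⟨i, Set.mem_iUnion.2 ⟨j, hpl⟩⟩⟩)
  · refine hz (Set.mem_iUnion.2 ⟨S, Set.mem_iUnion.2 ⟨i, Set.mem_iUnion.2 ⟨j, ?_⟩⟩⟩)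
    have hsub : affineSpan ℝ {M.vertex S i, M.vertex S j} ≤
        affineSpan ℝ {y, M.vertex S i, M.vertex S j} := affineSpan_mono ℝ (Set.subset_insert _ _)
    have hmem := AffineMap.lineMap_mem (t⁻¹) (mem_affineSpan ℝ (Set.mem_insert y _)) (hsub hpl)
    have hzz : AffineMap.lineMap y (AffineMap.lineMap y z t) t⁻¹ = z := by
      simp only [AffineMap.lineMap_apply, vsub_eq_sub, vadd_eq_add, add_sub_cancel_right,
        smul_smul, inv_mul_cancel₀ ht, one_smul, sub_add_cancel]
    rwa [hzz] at hmem

/-- Off the edges, two tetrahedra that meet share a face. -/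
theorem exists_face_of_mem_inter {T T' : Fin M.nt} (hne : T ≠ T') {x : E3} (hx : x ∈ M.tet T)
    (hx' : x ∈ M.tet T') (hedge : x ∉ M.edgeLines) :
    ∃ b b' : AffineBasis (Fin 4) ℝ E3, Set.range b = Set.range (M.vertex T) ∧
      Set.range b' = Set.range (M.vertex T') ∧ ∀ i, i ≠ 3 → b i = b' i := by
  obtain ⟨d, hd⟩ := M.exists_vertex_notMem hne
  -- With a second unshared vertex at most two would be shared, and the intersection would lie on an
  -- edge line.
  have hmem : ∀ i, i ≠ d → M.vertex T i ∈ Set.range (M.vertex T') := by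
    intro i hid
    by_contra hi
    have hcomb : ∀ i d : Fin 4, i ≠ d → ∃ k l, ∀ m, m ≠ i → m ≠ d → m = k ∨ m = l := by decide
    obtain ⟨k, l, hkl⟩ := hcomb i d hid
    have hsub : Set.range (M.vertex T) ∩ Set.range (M.vertex T') ⊆ {M.vertex T k, M.vertex T l} := by
      rintro _ ⟨⟨m, rfl⟩, hm⟩
      rcases hkl m (by rintro rfl; exact hi hm) (by rintro rfl; exact hd hm) with rfl | rfl
      · exact Set.mem_insert _ _
      · exact Set.mem_insert_of_mem _ rfl
    have hxm : x ∈ convexHull ℝ (Set.range (M.vertex T) ∩ Set.range (M.vertex T')) := by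
      rw [← M.inter_eq T T' hne]
      exact ⟨hx, hx'⟩
    exact hedge (Set.mem_iUnion.2 ⟨T, Set.mem_iUnion.2 ⟨k, Set.mem_iUnion.2 ⟨l,
      convexHull_subset_affineSpan _ (convexHull_mono hsub hxm)⟩⟩⟩)
  -- The swap gives the unshared vertex the number 3.
  have hσ := (Equiv.swap 3 d).bijective
  have hb := (M.basis T).range_renumber hσ
  obtain ⟨b', hb', hface⟩ := M.exists_basis_of_face (b := (M.basis T).renumber hσ) (S := T')
    fun i hi => hmem (Equiv.swap 3 d i) fun h => hi (by
      rwa [Equiv.swap_apply_eq_iff, Equiv.swap_apply_right] at h)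
  exact ⟨_, b', hb, hb', hface⟩

/-- A piecewise constant function that is orthogonal to the divergences of the conforming functions
is constant. -/
theorem const_eq_of_orthogonal (hconn : IsConnected Ω) (hreg : interior (closure Ω) = Ω)
    {p : E3 → ℝ} {c : Fin M.nt → ℝ}
    (hp : ∀ S, ∀ᵐ x ∂volume.restrict (interior (M.tet S)), p x = c S)
    (horth : ∀ v ∈ M.conformingP3, M.divForm v p = 0) (T T' : Fin M.nt) : c T = c T' := by
  have hopen : IsOpen Ω := hreg ▸ isOpen_interior
  have hcov : Ω ⊆ ⋃ S, M.tet S := M.iUnion_tet ▸ subset_closure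
  have hclosed : ∀ S, IsClosed (M.tet S) := fun S => (M.isCompact_tet S).isClosed
  have hoff : ∀ x ∉ M.edgeLines, ∀ S S', x ∈ M.tet S → x ∈ M.tet S' → c S = c S' := by
    intro x hx S S' hS hS'
    by_cases hSS : S = S'
    · rw [hSS]
    · obtain ⟨b, b', hb, hb', hface⟩ := M.exists_face_of_mem_inter hSS hS hS' hx
      exact const_eq_of_face hreg hSS hb hb' hface hp horth
  -- Tetrahedra meeting at x may share only an edge or a vertex. They are joined inside a ball in Ω
  -- by a segment whose end y avoids the edge lines and whose end z, chosen after y, avoids the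
  -- planes through y; both exceptional sets are null.
  have hloc : ∀ x ∈ Ω, ∀ S S', x ∈ M.tet S → x ∈ M.tet S' → c S = c S' := by
    intro x hx S S' hS hS'
    obtain ⟨ε, hε, hball⟩ := Metric.isOpen_iff.1 hopen x hx
    have hne : ∀ R, x ∈ M.tet R → (Metric.ball x ε ∩ interior (M.tet R)).Nonempty := fun R hR => by
      rw [← M.closure_interior_tet R] at hR
      exact mem_closure_iff.1 hR _ Metric.isOpen_ball (Metric.mem_ball_self hε)
    obtain ⟨y, ⟨hyB, hyS⟩, hyN⟩ := (Metric.isOpen_ball.inter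
      isOpen_interior).nonempty_diff_of_volume_eq_zero (hne S hS) M.volume_edgeLines
    obtain ⟨z, ⟨hzB, hzS⟩, hzN⟩ := (Metric.isOpen_ball.inter
      isOpen_interior).nonempty_diff_of_volume_eq_zero (hne S' hS') (M.volume_edgePlanes y)
    have hseg : segment ℝ y z ⊆ Ω :=
      ((convex_ball x ε).segment_subset hyB hzB).trans hball
    exact (convex_segment y z).isPreconnected.eq_of_closed_cover hclosed (hseg.trans hcov)
      (fun w hw => hoff w (M.notMem_edgeLines_of_mem_segment hyN hzN hw))
      ⟨y, left_mem_segment ℝ y z, interior_subset hyS⟩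
      ⟨z, right_mem_segment ℝ y z, interior_subset hzS⟩
  have hne : ∀ S, (Ω ∩ M.tet S).Nonempty := fun S => by
    obtain ⟨x, hx⟩ := M.nonempty_interior_tet S
    exact ⟨x, M.interior_tet_subset hreg S hx, interior_subset hx⟩
  exact hconn.isPreconnected.eq_of_closed_cover hclosed hcov hloc (hne T) (hne T')

theorem divForm_bubble (T : Fin M.nt) (i : Fin 9) (p : E3 → ℝ) :
    M.divForm (M.bubble T i) p = ∫ x in interior (M.tet T),
      divAt (mappedBubble fun k => M.basis T (renumbering i k)) x * p x := by
  rw [divForm, Finset.sum_eq_single T]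
  · refine setIntegral_congr_fun isOpen_interior.measurableSet fun x hx => ?_
    simp only [divAt]
    rw [M.fderiv_eq_of_eqOn (fun y hy => M.bubble_apply_self i hy) hx]
  · intro S _ hS
    rw [setIntegral_congr_fun (g := fun _ => (0 : ℝ)) isOpen_interior.measurableSet fun x hx => ?_]
    · simp
    · simp only [divAt]
      rw [M.fderiv_eq_of_eqOn (T := S) (g := fun _ => 0)
        (fun y hy => M.bubble_apply_of_ne hS.symm i hy) hx]
      simp
  · simp

/-- Only the zero pressure is orthogonal to all divergences. -/
theorem eq_zero_of_divForm_eq_zero (hconn : IsConnected Ω) (hreg : interior (closure Ω) = Ω)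
    {p : Lp ℝ 2 (volume.restrict Ω)} (hp : p ∈ M.pressureSpace)
    (h : ∀ v ∈ M.velocitySpace, M.divForm v p = 0) : p = 0 := by
  have hopen : IsOpen Ω := hreg ▸ isOpen_interior
  obtain ⟨⟨-, hmean⟩, hpoly⟩ := hp
  have hconst : ∀ T, ∃ c : ℝ, ∀ᵐ x ∂volume.restrict Ω, x ∈ M.tet T → p x = c := by
    intro T
    obtain ⟨q, hq, hqe⟩ := hpoly T
    have hqi : ∀ᵐ x ∂volume.restrict (interior (M.tet T)),
        p x = MvPolynomial.eval (fun k => x k) q := by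
      filter_upwards [M.ae_interior_of_ae hreg T hqe,
        ae_restrict_mem isOpen_interior.measurableSet] with x hx hxT
      exact hx (interior_subset hxT)
    -- Each bubble lives on a single tetrahedron, so orthogonality holds for T alone.
    obtain ⟨c, hc⟩ := (M.basis T).exists_eval_eq_const_of_orthogonal hq fun i => by
      rw [← h _ (M.bubble_mem_velocitySpace T i), divForm_bubble]
      refine integral_congr_ae ?_
      filter_upwards [hqi] with x hx
      rw [hx]
    refine ⟨c, ?_⟩
    filter_upwards [hqe] with x hx hxT
    rw [hx hxT, hc]
  choose c hc using hconst
  have hcc := M.const_eq_of_orthogonal hconn hreg (p := p) (c := c)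
    (fun S => by
      filter_upwards [M.ae_interior_of_ae hreg S (hc S),
        ae_restrict_mem isOpen_interior.measurableSet] with x hx hxS
      exact hx (interior_subset hxS))
    (fun v hv => h v (Submodule.mem_sup_left hv))
  obtain ⟨x₀, hx₀⟩ := hconn.nonempty
  obtain ⟨T₀, -⟩ := M.exists_tet_of_mem hx₀
  have hae : ∀ᵐ x ∂volume.restrict Ω, p x = c T₀ := by
    filter_upwards [ae_all_iff.2 hc, ae_restrict_mem hopen.measurableSet] with x hx hxΩ
    obtain ⟨T, hT⟩ := M.exists_tet_of_mem hxΩ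
    rw [hx T hT, hcc T T₀]
  have hfin := M.isFiniteMeasure_restrict
  have hvol : volume.real Ω ≠ 0 := by
    have h1 : volume Ω ≠ 0 := (hopen.measure_pos volume hconn.nonempty).ne'
    have h2 : volume Ω ≠ ⊤ := by simpa using measure_ne_top (volume.restrict Ω) Set.univ
    exact (ENNReal.toReal_ne_zero).2 ⟨h1, h2⟩
  -- The mean value condition now says that the constant times the positive finite volume of Ω is
  -- zero.
  rw [integral_congr_ae hae, setIntegral_const, smul_eq_mul] at hmean
  have hc0 : c T₀ = 0 := (mul_eq_zero.1 hmean).resolve_left hvol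
  refine Lp.ext ?_
  filter_upwards [hae, Lp.coeFn_zero ℝ 2 (volume.restrict Ω)] with x hx hx0
  rw [hx, hx0, hc0]
  rfl

end TetMesh

theorem lemma3p2 (Ω : Set E3) (hconn : IsConnected Ω) (hreg : interior (closure Ω) = Ω)
    (M : TetMesh Ω) (f : Lp E3 2 (volume.restrict Ω)) :
    ∃! up : M.velocitySpace × M.pressureSpace, M.IsDiscreteStokesSolution f up.1 up.2 := by
  have h := existsUnique_saddlePoint M.gradBilin (M.divBilin hreg) (M.loadFunctional f)
    (fun u hu => Subtype.ext (M.eq_zero_of_gradForm_self hconn hreg u.2 hu))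
    (fun p hp => Subtype.ext (M.eq_zero_of_divForm_eq_zero hconn hreg p.2
      fun v hv => hp ⟨v, hv⟩))
  refine (existsUnique_congr fun up => ?_).1 h
  exact ⟨fun h => ⟨fun v hv => h.1 ⟨v, hv⟩, fun q hq => h.2 ⟨q, hq⟩⟩,
    fun h => ⟨fun v => h.1 v v.2, fun q => h.2 q q.2⟩⟩
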